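/- Let $E$ be a completely regular Hausdorff space with Borel $\sigma$-algebra $\mathcal B(E)$, and let $\rho:E\to(0,\infty)$ be an admissible weight function (every set $\{\rho\le R\}$, $R\ge 0$, is compact) that is measurable with respect to the Baire $\sigma$-algebra $\mathcal B_0(E)$ (generated by the real continuous functions). Let $\mathscr B^\rho(E)$ be the closure of $C_b(E)$ under the norm $\|f\|_\rho=\sup_{x}|f(x)|/\rho(x)$, and let $\mathcal M^\rho(E)$ be the set of signed Radon measures $\mu$ on $E$ with $\int\rho\,d|\mu|<\infty$. Let $(P(t))_{t\ge 0}$ be a generalized Feller semigroup on $\mathscr B^\rho(E)$, i.e. a family of bounded linear operators on $\mathscr B^\rho(E)$ with $P(0)=\mathrm{Id}$, $P(t+s)=P(s)P(t)$, $\lim_{t\searrow 0}P(t)f(x)=f(x)$ for all $f\in\mathscr B^\rho(E)$ and $x\in E$, $\|P(t)\|\le C$ for all $t\in[0,\varepsilon]$ for some $\varepsilon>0$ and $C\in\mathbb R$, and each $P(t)$ positive. Suppose that $P(t)1=1$ and $\|P(t)\|\le 1$ for all $t$. Write $p(t)(x,\cdot)$ for the unique nonnegative measure in $\mathcal M^\rho(E)$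 with $P(t)f(x)=\int f(y)\,p(t)(x,dy)$ for all $f\in\mathscr B^\rho(E)$, and put $P(t)g(x)=\int g(y)\,p(t)(x,dy)$ also for Baire measurable $g$ with $|g|\le c\rho$ for some constant $c$. Let $T>0$ and let $\nu\in\mathcal M^\rho(E)$ be a probability measure. Suppose that the following two laws are given. * The law $\mathbb P_\nu$ of a generalized Feller process: a probability measure on $(E^{[0,T]},\mathcal B(E)^{[0,T]})$ such that the canonical process $(\lambda_t)$ has $\lambda_0\sim\nu$, is adapted to some filtration $(\mathcal F_t)$, and satisfies, for all $0\le s\le t\le T$ and $f\in\mathscr B^\rho(E)$, that $f(\lambda_t)$ is integrable and $\mathbb E_\nu[f(\lambda_t)\,|\,\mathcal F_s]=P(t-s)f(\lambda_s)$ almost surely. * The law $\mathbb P'_\nu$ of an extended Feller process: with a cemetery $\Delta\notin E$, $E_\Delta=E\cup\{\Delta\}$, $\mathcal B(E_\Delta)=\sigma(\mathcal B(E),\{\Delta\})$, and functions on $E$ extended by the value $0$ at $\Delta$, a probability measure on $(E_\Delta^{[0,T]},\mathcal B(E_\Delta)^{[0,T]})$ such that the canonical process $(\gamma_t)$ has $\gamma_0\sim\nu$,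 is adapted to some filtration $(\mathcal F'_t)$, and satisfies, for all $0\le s\le t\le T$ and all bounded Baire measurable $f:E\to\mathbb R$, $\mathbb E_{\mathbb P'_\nu}[f(\gamma_t)\,|\,\mathcal F'_s]=\frac{P(t-s)(f\cdot\rho)}{\rho}(\gamma_s)$ almost surely. Suppose moreover that the law of each $\lambda_t$ on $E$, and the restriction to $E$ of the law of each $\gamma_t$, is a Radon measure. Let $\mathbb P'_\nu|_{\mathcal B(E)^{[0,T]}}$ denote the trace of $\mathbb P'_\nu$ on $E^{[0,T]}\subset E_\Delta^{[0,T]}$, that is, the measure on $(E^{[0,T]},\mathcal B(E)^{[0,T]})$ that assigns to $A$ the outer $\mathbb P'_\nu$-measure of $A$, written $\mathbb P'_\nu[A]$. Then for all $A\in\mathcal B(E)^{[0,T]}$ $$\mathbb P'_\nu[A]=\mathbb E_{\mathbb P_\nu}\Big[1_A\,\frac{\rho(\lambda_T)}{\rho(\lambda_0)}\Big]\qquad\text{and}\qquad \mathbb E_{\mathbb P'_\nu}\Big[1_A\,\frac{\rho(\gamma_0)}{\rho(\gamma_T)}\Big]=\mathbb P_\nu[A],$$ where the second expectation is the integral over $A$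 with respect to $\mathbb P'_\nu|_{\mathcal B(E)^{[0,T]}}$. Hence $\mathbb P'_\nu|_{\mathcal B(E)^{[0,T]}}$ and $\mathbb P_\nu$ are equivalent measures (mutually absolutely continuous). -/

import Mathlib

open MeasureTheory Filter Topology
open scoped NNReal ENNReal BoundedContinuousFunction

/-- An admissible weight function on `E`: a map `ρ : E → (0, ∞)` all of whose sublevel sets
`K_R = {ρ ≤ R}`, `R ≥ 0`, are compact.  The pair `(E, ρ)` is called a weighted space. -/
structure AdmissibleWeight (E : Type*) [TopologicalSpace E] where
  toFun : E → ℝ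
  pos : ∀ x, 0 < toFun x
  isCompact_sublevel : ∀ R : ℝ, 0 ≤ R → IsCompact {x | toFun x ≤ R}

instance {E : Type*} [TopologicalSpace E] : CoeFun (AdmissibleWeight E) (fun _ => E → ℝ) :=
  ⟨AdmissibleWeight.toFun⟩

namespace AdmissibleWeight

theorem lowerSemicontinuous {E : Type*} [TopologicalSpace E] [T2Space E]
    (ρ : AdmissibleWeight E) : LowerSemicontinuous ρ := by
  rw [lowerSemicontinuous_iff_isClosed_preimage]
  intro y
  rcases le_or_gt 0 y with hy | hy
  · exact (ρ.isCompact_sublevel y hy).isClosed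
  · have h : (ρ : E → ℝ) ⁻¹' Set.Iic y = ∅ := by
      ext x
      simp only [Set.mem_preimage, Set.mem_Iic, Set.mem_empty_iff_false, iff_false, not_le]
      exact hy.trans (ρ.pos x)
    rw [h]
    exact isClosed_empty

/-- An admissible weight is bounded below by a positive constant. -/
theorem exists_lower_bound {E : Type*} [TopologicalSpace E] [T2Space E]
    (ρ : AdmissibleWeight E) : ∃ c : ℝ, 0 < c ∧ ∀ x, c ≤ ρ x := by
  rcases isEmpty_or_nonempty E with hE | ⟨⟨x₀⟩⟩
  · exact ⟨1, one_pos, fun x => (hE.false x).elim⟩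
  · obtain ⟨a, -, ha⟩ := LowerSemicontinuousOn.exists_isMinOn (s := {x | ρ x ≤ ρ x₀})
      ⟨x₀, le_refl (ρ x₀)⟩ (ρ.isCompact_sublevel _ (ρ.pos x₀).le)
      (ρ.lowerSemicontinuous.lowerSemicontinuousOn _)
    refine ⟨ρ a, ρ.pos a, fun x => ?_⟩
    rcases le_total (ρ x) (ρ x₀) with hx | hx
    · exact ha hx
    · exact (ha (show x₀ ∈ {x | ρ x ≤ ρ x₀} from le_refl (ρ x₀))).trans hx

end AdmissibleWeight

/-- The functions `f : E → ℝ` lying in the closure of `C_b(E)` with respect to the weighted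
supremum norm `‖f‖_ρ = sup_x |f x| / ρ x`. -/
def BrhoSubmodule {E : Type*} [TopologicalSpace E] (ρ : AdmissibleWeight E) :
    Submodule ℝ (E → ℝ) where
  carrier := {f | ∀ ε : ℝ, 0 < ε → ∃ g : E →ᵇ ℝ, ∀ x, |f x - g x| ≤ ε * ρ x}
  zero_mem' := fun ε hε => ⟨0, fun x => by simpa using mul_nonneg hε.le (ρ.pos x).le⟩
  add_mem' := by
    intro f₁ f₂ h₁ h₂ ε hε
    obtain ⟨g₁, hg₁⟩ := h₁ (ε / 2) (by positivity)
    obtain ⟨g₂, hg₂⟩ := h₂ (ε / 2) (by positivity)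
    refine ⟨g₁ + g₂, fun x => ?_⟩
    have e : (f₁ + f₂) x - (g₁ + g₂) x = (f₁ x - g₁ x) + (f₂ x - g₂ x) := by
      simp only [Pi.add_apply, BoundedContinuousFunction.coe_add]
      ring
    rw [e]
    refine (abs_add_le _ _).trans ?_
    linarith [hg₁ x, hg₂ x]
  smul_mem' := by
    intro c f h ε hε
    obtain ⟨g, hg⟩ := h (ε / (|c| + 1)) (by positivity)
    refine ⟨c • g, fun x => ?_⟩
    have e : (c • f) x - (c • g) x = c * (f x - g x) := by
      simp only [Pi.smul_apply, BoundedContinuousFunction.coe_smul, smul_eq_mul]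
      ring
    rw [e, abs_mul]
    have h1 : |c| * |f x - g x| ≤ |c| * (ε / (|c| + 1) * ρ x) :=
      mul_le_mul_of_nonneg_left (hg x) (abs_nonneg c)
    have h2 : |c| * (ε / (|c| + 1) * ρ x) ≤ ε * ρ x := by
      have h3 : |c| * (ε / (|c| + 1)) ≤ ε := by
        rw [mul_div_assoc', div_le_iff₀ (by positivity)]
        nlinarith [abs_nonneg c]
      nlinarith [mul_le_mul_of_nonneg_right h3 (ρ.pos x).le]
    exact h1.trans h2

/-- The Banach space `𝓑^ρ(E)` of functions with growth controlled by `ρ`. It is a type of its own,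
so that it carries the weighted norm and not the topology of pointwise convergence. -/
def Brho {E : Type*} [TopologicalSpace E] (ρ : AdmissibleWeight E) : Type _ :=
  ↥(BrhoSubmodule ρ)

namespace Brho

variable {E : Type*} [TopologicalSpace E] {ρ : AdmissibleWeight E}

noncomputable instance : AddCommGroup (Brho ρ) := inferInstanceAs (AddCommGroup ↥(BrhoSubmodule ρ))

noncomputable instance : Module ℝ (Brho ρ) := inferInstanceAs (Module ℝ ↥(BrhoSubmodule ρ))

instance : CoeFun (Brho ρ) (fun _ => E → ℝ) := ⟨fun f => f.1⟩

@[ext] theorem ext {f g : Brho ρ} (h : ∀ x, f x = g x) : f = g := Subtype.ext (funext h)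

@[simp] theorem zero_apply (x : E) : (0 : Brho ρ) x = 0 := rfl

@[simp] theorem add_apply (f g : Brho ρ) (x : E) : (f + g) x = f x + g x := rfl

@[simp] theorem smul_apply (c : ℝ) (f : Brho ρ) (x : E) : (c • f) x = c * f x := rfl

/-- Bounded continuous functions belong to `𝓑^ρ(E)`. -/
def ofBCF (ρ : AdmissibleWeight E) (g : E →ᵇ ℝ) : Brho ρ :=
  ⟨g, fun ε hε => ⟨g, fun x => by simpa using mul_nonneg hε.le (ρ.pos x).le⟩⟩

@[simp] theorem ofBCF_apply (g : E →ᵇ ℝ) (x : E) : ofBCF ρ g x = g x := rfl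

/-- `‖f‖_ρ = sup_x |f x| / ρ x`. -/
noncomputable instance : Norm (Brho ρ) := ⟨fun f => ⨆ x, |f x| / ρ x⟩

theorem norm_def (f : Brho ρ) : ‖f‖ = ⨆ x, |f x| / ρ x := rfl

theorem bddAbove [T2Space E] (f : Brho ρ) : BddAbove (Set.range fun x => |f x| / ρ x) := by
  obtain ⟨c, hc, hρ⟩ := ρ.exists_lower_bound
  obtain ⟨g, hg⟩ := f.2 1 one_pos
  refine ⟨1 + ‖g‖ / c, ?_⟩
  rintro _ ⟨x, rfl⟩
  show |f x| / ρ x ≤ 1 + ‖g‖ / c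
  rw [div_le_iff₀ (ρ.pos x)]
  have h1 : |f x| ≤ |f x - g x| + |g x| := by
    simpa using abs_add_le (f x - g x) (g x)
  have h2 : |g x| ≤ ‖g‖ := g.norm_coe_le_norm x
  have h3 : ‖g‖ ≤ ‖g‖ / c * ρ x := by
    rw [div_mul_eq_mul_div, le_div_iff₀ hc]
    exact mul_le_mul_of_nonneg_left (hρ x) (norm_nonneg _)
  have h4 : |f x - g x| ≤ 1 * ρ x := hg x
  linarith

theorem abs_apply_le [T2Space E] (f : Brho ρ) (x : E) : |f x| ≤ ‖f‖ * ρ x := by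
  rw [← div_le_iff₀ (ρ.pos x)]
  exact le_ciSup (bddAbove f) x

theorem norm_le {f : Brho ρ} {C : ℝ} (hC : 0 ≤ C) (h : ∀ x, |f x| ≤ C * ρ x) : ‖f‖ ≤ C :=
  Real.iSup_le (fun x => (div_le_iff₀ (ρ.pos x)).2 (h x)) hC

theorem norm_nonneg' (f : Brho ρ) : 0 ≤ ‖f‖ :=
  Real.iSup_nonneg fun x => div_nonneg (abs_nonneg _) (ρ.pos x).le

theorem core [T2Space E] : NormedSpace.Core ℝ (Brho ρ) where
  norm_nonneg := norm_nonneg'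
  norm_smul := by
    intro c f
    have h : ∀ x, |(c • f) x| / ρ x = |c| * (|f x| / ρ x) := fun x => by
      rw [smul_apply, abs_mul, mul_div_assoc]
    rw [norm_def, norm_def, Real.norm_eq_abs, Real.mul_iSup_of_nonneg (abs_nonneg c)]
    exact iSup_congr h
  norm_triangle := by
    intro f g
    refine norm_le (add_nonneg (norm_nonneg' f) (norm_nonneg' g)) fun x => ?_
    rw [add_apply, add_mul]
    exact (abs_add_le _ _).trans (add_le_add (abs_apply_le f x) (abs_apply_le g x))
  norm_eq_zero_iff := by
    intro f
    constructor
    · intro h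
      ext x
      have hx := abs_apply_le f x
      rw [h, zero_mul] at hx
      simpa using le_antisymm hx (abs_nonneg _)
    · rintro rfl
      refine le_antisymm (norm_le le_rfl fun x => ?_) (norm_nonneg' _)
      simp

noncomputable instance [T2Space E] : NormedAddCommGroup (Brho ρ) := NormedAddCommGroup.ofCore core

noncomputable instance [T2Space E] : NormedSpace ℝ (Brho ρ) := NormedSpace.ofCore core

end Brho

/-- Generalized Feller semigroups on `𝓑^ρ(E)`: properties P1 to P5. -/
structure IsGeneralizedFellerSemigroup {E : Type*} [TopologicalSpace E] [T2Space E]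
    {ρ : AdmissibleWeight E} (P : ℝ≥0 → Brho ρ →L[ℝ] Brho ρ) : Prop where
  zero : P 0 = ContinuousLinearMap.id ℝ (Brho ρ)
  add : ∀ s t, P (t + s) = (P s).comp (P t)
  tendsto : ∀ (f : Brho ρ) (x : E), Tendsto (fun t => P t f x) (𝓝[>] 0) (𝓝 (f x))
  locally_bounded : ∃ ε : ℝ≥0, 0 < ε ∧ ∃ C : ℝ, ∀ t ≤ ε, ‖P t‖ ≤ C
  positive : ∀ (t : ℝ≥0) (f : Brho ρ), (∀ x, 0 ≤ f x) → ∀ x, 0 ≤ P t f x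

/-- The Baire `σ`-algebra: the smallest `σ`-algebra making all real continuous functions
measurable. -/
@[reducible]
def baireSigmaAlgebra (E : Type*) [TopologicalSpace E] : MeasurableSpace E :=
  ⨆ f : C(E, ℝ), MeasurableSpace.comap f (borel ℝ)

/-- The nonnegative elements of `𝓜^ρ(E)`: finite Radon (inner regular) Borel measures
that integrate `ρ`. -/
structure MemMrho {E : Type*} [TopologicalSpace E] [MeasurableSpace E]
    (ρ : AdmissibleWeight E) (μ : Measure E) : Prop where
  isFinite : IsFiniteMeasure μ
  innerRegular : μ.InnerRegular
  lintegral_lt_top : ∫⁻ x, ENNReal.ofReal (ρ x) ∂μ < ∞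

open Classical in
/-- The measure `p(t)(x, ·)` of a generalized Feller semigroup: the (unique) nonnegative measure
in `𝓜^ρ(E)` with `P(t) f (x) = ∫ f(y) p(t)(x, dy)` for all `f ∈ 𝓑^ρ(E)`. -/
noncomputable def transitionMeasure {E : Type*} [TopologicalSpace E] [T2Space E]
    [MeasurableSpace E] {ρ : AdmissibleWeight E} (P : ℝ≥0 → Brho ρ →L[ℝ] Brho ρ)
    (t : ℝ≥0) (x : E) : Measure E :=
  if h : ∃ μ : Measure E, MemMrho ρ μ ∧ ∀ f : Brho ρ, P t f x = ∫ y, f y ∂μ then h.choose else 0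

/-- `P(t) g (x) = ∫ g(y) p(t)(x, dy)` for measurable `g` whose modulus is bounded by a multiple
of `ρ`. -/
noncomputable def extendedAction {E : Type*} [TopologicalSpace E] [T2Space E]
    [MeasurableSpace E] {ρ : AdmissibleWeight E} (P : ℝ≥0 → Brho ρ →L[ℝ] Brho ρ)
    (t : ℝ≥0) (g : E → ℝ) (x : E) : ℝ :=
  ∫ y, g y ∂(transitionMeasure P t x)

/-- The state space `E ∪ {Δ}` with the cemetery `Δ = none`. -/
def WithCemetery (E : Type*) : Type _ := Option E

namespace WithCemetery

variable {E : Type*}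

/-- The inclusion `E ⊆ E ∪ {Δ}`. -/
def incl (x : E) : WithCemetery E := some x

/-- The cemetery. -/
def cemetery : WithCemetery E := none

theorem incl_injective : Function.Injective (incl : E → WithCemetery E) :=
  Option.some_injective E

/-- The extension of a function on `E` to `E ∪ {Δ}` by `f(Δ) = 0`. -/
def extend (f : E → ℝ) (y : WithCemetery E) : ℝ := Option.elim y 0 f

/-- The `σ`-algebra of all `S` with `S ∩ E` measurable, that is `σ(𝓑(E), {Δ})`. -/
instance [MeasurableSpace E] : MeasurableSpace (WithCemetery E) :=
  MeasurableSpace.map (incl : E → WithCemetery E) inferInstance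

theorem measurable_incl [MeasurableSpace E] : Measurable (incl : E → WithCemetery E) :=
  fun _ h => h

theorem measurableSet_image_incl [MeasurableSpace E] {S : Set E} (hS : MeasurableSet S) :
    MeasurableSet (incl '' S) := by
  show MeasurableSet (incl ⁻¹' (incl '' S))
  rwa [Set.preimage_image_eq _ incl_injective]

theorem measurableSpace_eq_generateFrom [MeasurableSpace E] :
    (inferInstance : MeasurableSpace (WithCemetery E)) =
      MeasurableSpace.generateFrom
        ({S | ∃ B : Set E, MeasurableSet B ∧ S = incl '' B} ∪ {{cemetery}}) := by
  apply le_antisymm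
  · intro S hS
    have h1 : MeasurableSet[MeasurableSpace.generateFrom
        ({S | ∃ B : Set E, MeasurableSet B ∧ S = incl '' B} ∪ {{cemetery}})]
        (incl '' (incl ⁻¹' S)) :=
      MeasurableSpace.measurableSet_generateFrom (Or.inl ⟨_, hS, rfl⟩)
    have h2 : MeasurableSet[MeasurableSpace.generateFrom
        ({S | ∃ B : Set E, MeasurableSet B ∧ S = incl '' B} ∪ {{cemetery}})]
        ({cemetery} : Set (WithCemetery E)) :=
      MeasurableSpace.measurableSet_generateFrom (Or.inr rfl)
    by_cases hc : (cemetery : WithCemetery E) ∈ S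
    · have e : S = incl '' (incl ⁻¹' S) ∪ {cemetery} := by
        ext y
        rcases y with _ | x
        · exact ⟨fun _ => Or.inr rfl, fun _ => hc⟩
        · refine ⟨fun h => Or.inl ⟨x, h, rfl⟩, ?_⟩
          rintro (⟨z, hz, h⟩ | h)
          · exact h ▸ hz
          · cases h
      rw [e]
      exact MeasurableSet.union h1 h2
    · have e : S = incl '' (incl ⁻¹' S) := by
        ext y
        rcases y with _ | x
        · refine ⟨fun h => (hc h).elim, ?_⟩
          rintro ⟨z, hz, h⟩
          cases h
        · refine ⟨fun h => ⟨x, h, rfl⟩, ?_⟩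
          rintro ⟨z, hz, h⟩
          exact h ▸ hz
      rw [e]
      exact h1
  · refine MeasurableSpace.generateFrom_le ?_
    rintro S (⟨B, hB, rfl⟩ | rfl)
    · exact measurableSet_image_incl hB
    · show MeasurableSet (incl ⁻¹' {cemetery})
      have e : (incl ⁻¹' {cemetery} : Set E) = ∅ := by
        ext x
        refine ⟨fun h => ?_, fun h => h.elim⟩
        cases h
      rw [e]
      exact MeasurableSet.empty

/-- The inclusion `E^I ⊆ (E ∪ {Δ})^I`. -/
def inclPath {I : Type*} (x : I → E) : I → WithCemetery E := fun t => incl (x t)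

theorem inclPath_injective {I : Type*} :
    Function.Injective (inclPath : (I → E) → (I → WithCemetery E)) :=
  fun _ _ h => funext fun t => incl_injective (congrFun h t)

theorem pi_le_comap_inclPath {I : Type*} [MeasurableSpace E] :
    (MeasurableSpace.pi : MeasurableSpace (I → E)) ≤
      MeasurableSpace.comap inclPath MeasurableSpace.pi := by
  refine iSup_le fun t => ?_
  rintro _ ⟨S, hS, rfl⟩
  refine ⟨(fun y : I → WithCemetery E => y t) ⁻¹' (incl '' S),
    measurable_pi_apply t (measurableSet_image_incl hS), ?_⟩
  ext x
  exact incl_injective.mem_set_image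

theorem pi_le_caratheodory {I : Type*} [MeasurableSpace E]
    (m : Measure (I → WithCemetery E)) :
    (MeasurableSpace.pi : MeasurableSpace (I → E)) ≤
      (OuterMeasure.comap inclPath m.toOuterMeasure).caratheodory := by
  intro A hA
  obtain ⟨B, hB, rfl⟩ := pi_le_comap_inclPath A hA
  rw [OuterMeasure.isCaratheodory_iff]
  intro S
  simp only [OuterMeasure.comap_apply, Set.image_inter_preimage, Set.image_sdiff_preimage]
  exact (measure_inter_add_sdiff (inclPath '' S) hB).symm

/-- The restriction (trace) to `E^I`, with its product `σ`-algebra, of a measure `m` on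
`(E ∪ {Δ})^I`.  As `E^I` need not be measurable in `(E ∪ {Δ})^I`, the value at `A` is the outer
measure of `A ⊆ (E ∪ {Δ})^I` under `m`, see `trace_apply`. -/
noncomputable def trace {I : Type*} [MeasurableSpace E] (m : Measure (I → WithCemetery E)) :
    Measure (I → E) :=
  (OuterMeasure.comap inclPath m.toOuterMeasure).toMeasure (pi_le_caratheodory m)

theorem trace_apply {I : Type*} [MeasurableSpace E] (m : Measure (I → WithCemetery E))
    {A : Set (I → E)} (hA : MeasurableSet A) : trace m A = m (inclPath '' A) := by
  rw [trace, toMeasure_apply _ _ hA]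
  rfl

end WithCemetery

/-- The time interval `[0, T]`. -/
abbrev TimeInterval (T : ℝ≥0) : Type := Set.Icc (0 : ℝ≥0) T

namespace TimeInterval

/-- The initial time `0 ∈ [0, T]`. -/
def initial (T : ℝ≥0) : TimeInterval T := ⟨0, le_rfl, zero_le⟩

/-- The final time `T ∈ [0, T]`. -/
def final (T : ℝ≥0) : TimeInterval T := ⟨T, zero_le, le_rfl⟩

end TimeInterval

/-- `ℙ` is the law `ℙ_ν` on `E^{[0,T]}`, with the product `σ`-algebra of the Borel `σ`-algebras,
under which the canonical process `λ_t(x) = x t` is a generalized Feller process with respect to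
the filtration `ℱ`, the semigroup `P` and the initial distribution `ν ∈ 𝓜^ρ(E)`.
The last field says that the law of each `λ_t` is a Radon measure; it is needed as the other
conditions concern only Baire sets at positive times. -/
structure IsGeneralizedFellerLaw {E : Type*} [TopologicalSpace E] [T2Space E] [MeasurableSpace E]
    {ρ : AdmissibleWeight E} (P : ℝ≥0 → Brho ρ →L[ℝ] Brho ρ) (ν : Measure E) (T : ℝ≥0)
    (ℱ : Filtration (TimeInterval T) (MeasurableSpace.pi (X := fun _ : TimeInterval T => E)))
    (ℙ : Measure (TimeInterval T → E)) : Prop where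
  isProbabilityMeasure : IsProbabilityMeasure ℙ
  initial_memMrho : MemMrho ρ ν
  adapted : ∀ t : TimeInterval T, Measurable[ℱ t] fun x : TimeInterval T → E => x t
  initial_law : ℙ.map (fun x => x (TimeInterval.initial T)) = ν
  integrable : ∀ (t : TimeInterval T) (f : Brho ρ), Integrable (fun x => f (x t)) ℙ
  condExp_eq : ∀ s t : TimeInterval T, s ≤ t → ∀ f : Brho ρ,
    ℙ[fun x => f (x t) | ℱ s] =ᵐ[ℙ] fun x => P ((t : ℝ≥0) - (s : ℝ≥0)) f (x s)
  radon_marginal : ∀ t : TimeInterval T, (ℙ.map fun x => x t).InnerRegular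

/-- `ℙ'` is the law `ℙ'_ν` on `(E ∪ {Δ})^{[0,T]}` under which the canonical process
`γ_t(y) = y t` is an extended Feller process with respect to the filtration `ℱ`, the semigroup `P`
and the initial distribution `ν` (a probability measure on `E ∪ {Δ}`).
Functions on `E` are extended to `E ∪ {Δ}` by the value `0` at `Δ`.
The last field says that the law of each `γ_t` is Radon on `E`. -/
structure IsExtendedFellerLaw {E : Type*} [TopologicalSpace E] [T2Space E] [MeasurableSpace E]
    {ρ : AdmissibleWeight E} (P : ℝ≥0 → Brho ρ →L[ℝ] Brho ρ) (ν : Measure (WithCemetery E))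
    (T : ℝ≥0)
    (ℱ : Filtration (TimeInterval T)
      (MeasurableSpace.pi (X := fun _ : TimeInterval T => WithCemetery E)))
    (ℙ' : Measure (TimeInterval T → WithCemetery E)) : Prop where
  isProbabilityMeasure : IsProbabilityMeasure ℙ'
  adapted : ∀ t : TimeInterval T, Measurable[ℱ t] fun y : TimeInterval T → WithCemetery E => y t
  initial_law : ℙ'.map (fun y => y (TimeInterval.initial T)) = ν
  condExp_eq : ∀ s t : TimeInterval T, s ≤ t → ∀ f : E → ℝ,
    Measurable[baireSigmaAlgebra E] f → (∃ C : ℝ, ∀ x, |f x| ≤ C) →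
    ℙ'[fun y => WithCemetery.extend f (y t) | ℱ s] =ᵐ[ℙ'] fun y =>
      WithCemetery.extend
        (fun x => extendedAction P ((t : ℝ≥0) - (s : ℝ≥0)) (fun z => f z * ρ z) x / ρ x) (y s)
  radon_marginal : ∀ t : TimeInterval T,
    ((ℙ'.map fun y => y t).comap WithCemetery.incl).InnerRegular

/-! The extended process is a Doob-type transform of the generalized Feller process by `ρ`. Its
transition operators `g ↦ P(t)(gρ)/ρ` have kernels `ρ(y)/ρ(x) p(t)(x,dy)`. Along times `0 ≤ t₁ < … <
tₙ ≤ T` the ratios telescope, and only `ρ(λ_T)/ρ(λ_0)` remains. So this is the density on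
finite-dimensional events of being in prescribed sets and alive at `T`
(`lintegral_prod_extended_eq`).

Three points need care. First, `transitionMeasure` is defined by choice, so the existence of
`p(t)(x,·)` must be proved. This is a Riesz theorem on `𝓑^ρ(E)`, obtained through the Stone–Čech
compactification (`exists_memMrho`).

Second, the Markov properties concern only Baire test functions, while paths carry the product of
Borel σ-algebras. As all marginals are Radon, each Borel coordinate set can be exchanged for a Baire
set up to a null set (`exists_baire_ae_eq_marginals`).

Third, `E^{[0,T]}` need not be measurable among the paths with cemetery. But a measurable set
involves only countably many times, and a path alive at `T` was almost surely alive at each of them.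
Hence the trace of an event is its probability intersected with survival up to `T`
(`IsExtendedFellerLaw.trace_preimage_inclPath`).

Square cylinders form a π-system, so the density is identified on all measurable sets
(`trace_eq_withDensity`). It is strictly positive and finite everywhere, which yields the inverse
formula and the equivalence. -/

namespace AdmissibleWeight

/-! ### Topology of weighted spaces -/

variable {E : Type*} [TopologicalSpace E] (ρ : AdmissibleWeight E)

theorem iUnion_sublevel : ⋃ n : ℕ, {x | ρ x ≤ n} = Set.univ :=
  Set.eq_univ_of_forall fun x => Set.mem_iUnion.2 (exists_nat_ge (ρ x))

theorem sigmaCompactSpace {E : Type*} [TopologicalSpace E] (ρ : AdmissibleWeight E) :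
    SigmaCompactSpace E :=
  ⟨⟨fun n => {x | ρ x ≤ n}, fun n => ρ.isCompact_sublevel n n.cast_nonneg, ρ.iUnion_sublevel⟩⟩

/-- The compact sublevel sets exhaust `E`, so `E` is Lindelöf, and a regular Lindelöf space is
normal. This gives Urysohn functions for disjoint closed sets. -/
theorem normalSpace {E : Type*} [TopologicalSpace E] [T35Space E] (ρ : AdmissibleWeight E) : NormalSpace E :=
  have := ρ.sigmaCompactSpace
  inferInstance

theorem isClosed_sublevel [T2Space E] (R : ℝ) : IsClosed {x | ρ x ≤ R} :=
  ρ.lowerSemicontinuous.isClosed_preimage R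

theorem measurable [T2Space E] [MeasurableSpace E] [BorelSpace E] : Measurable ρ :=
  ρ.lowerSemicontinuous.measurable

/-- Bounded Urysohn functions on a weighted space. -/
theorem exists_bcf_one_zero {E : Type*} [TopologicalSpace E] [T35Space E]
    (ρ : AdmissibleWeight E) {K F : Set E} (hK : IsClosed K) (hF : IsClosed F)
    (hKF : Disjoint K F) : ∃ g : E →ᵇ ℝ, (∀ x ∈ K, g x = 1) ∧ (∀ x ∈ F, g x = 0) ∧
      ∀ x, 0 ≤ g x ∧ g x ≤ 1 := by
  have := ρ.normalSpace
  obtain ⟨f, h0, h1, h⟩ := exists_continuous_zero_one_of_isClosed hF hK hKF.symm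
  exact ⟨BoundedContinuousFunction.mkOfBound f 1 fun x y => by
    rw [Real.dist_eq, abs_le]; constructor <;> linarith [(h x).1, (h x).2, (h y).1, (h y).2],
    fun x hx => h1 hx, fun x hx => h0 hx, h⟩

end AdmissibleWeight

/-! ### Riesz representation on `𝓑^ρ(E)` -/

/-- The sum is a staircase that rounds `r` down to the grid of mesh `δ`: a threshold counts only
once it is strictly exceeded. With `r = ρ x` the thresholds cut out superlevel sets, open by lower
semicontinuity. -/
theorem sum_step_le {r δ : ℝ} (hr : 0 ≤ r) (hδ : 0 < δ) (N : ℕ) :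
    (∑ i ∈ Finset.range N, if (i + 1) * δ < r then δ else 0) ≤ r := by
  have key : ∀ N : ℕ, (∑ i ∈ Finset.range N, if (i + 1) * δ < r then δ else 0) ≤ N * δ := fun N => by
    calc _ ≤ ∑ i ∈ Finset.range N, δ := Finset.sum_le_sum fun i _ => by split_ifs <;> linarith
      _ = N * δ := by simp
  induction N with
  | zero => simpa
  | succ N ih =>
    rw [Finset.sum_range_succ]
    split_ifs with h
    · linarith [key N]
    · simpa using ih

theorem le_sum_step_add {r δ : ℝ} (hδ : 0 < δ) (N : ℕ) (hN : r ≤ N * δ) :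
    r ≤ (∑ i ∈ Finset.range N, if (i + 1) * δ < r then δ else 0) + δ := by
  have key : ∀ N : ℕ, (∑ i ∈ Finset.range N, if (i + 1) * δ < r then δ else 0) = N * δ ∨
      r ≤ (∑ i ∈ Finset.range N, if (i + 1) * δ < r then δ else 0) + δ := by
    intro N
    induction N with
    | zero => left; simp
    | succ N ih =>
      rw [Finset.sum_range_succ]
      rcases ih with ih | ih
      · split_ifs with h
        · left; rw [ih]; push_cast; ring
        · right; rw [ih]; linarith
      · right
        split_ifs <;> linarith
  rcases key N with h | h
  · rw [h]; linarith
  · exact h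

section Riesz

variable {E : Type*} [TopologicalSpace E] [T35Space E] [MeasurableSpace E] [BorelSpace E]
  (ρ : AdmissibleWeight E)

/-- The integral of the weight is controlled by those of its bounded continuous minorants. -/
theorem lintegral_weight_le (μ : Measure E) [IsFiniteMeasure μ] (hμ : μ.InnerRegular) {C : ℝ}
    (hC : ∀ g : E →ᵇ ℝ, (∀ x, 0 ≤ g x) → (∀ x, g x ≤ ρ x) → ∫ x, g x ∂μ ≤ C) :
    ∫⁻ x, ENNReal.ofReal (ρ x) ∂μ ≤ ENNReal.ofReal C := by
  have hmeas : ∀ a : ℝ, MeasurableSet {x | a < ρ x} := fun a =>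
    measurableSet_lt measurable_const ρ.measurable
  -- Layer cake: each superlevel set is nearly exhausted by a compact set, and a Urysohn function
  -- lies between the two indicators. By `sum_step_le`, `δ` times the sum of these functions is a
  -- bounded continuous minorant of `ρ`, to which `hC` applies.
  have hsum : ∀ δ : ℝ, 0 < δ → ∀ N : ℕ,
      ∑ i ∈ Finset.range N, δ * μ.real {x | (i + 1) * δ < ρ x} ≤ C := by
    intro δ hδ N
    refine le_of_forall_pos_le_add fun ε hε => ?_
    -- The `N` errors, each weighted by `δ`, add up to at most `ε`; the `+ 1` keeps the denominator
    -- positive when `N = 0`.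
    have hε' : 0 < ε / (N * δ + 1) := by positivity
    have : ∀ i : ℕ, ∃ g : E →ᵇ ℝ, (∀ x, 0 ≤ g x) ∧
        (∀ x, g x ≤ if (i + 1) * δ < ρ x then 1 else 0) ∧
        μ.real {x | (i + 1) * δ < ρ x} ≤ ∫ x, g x ∂μ + ε / (N * δ + 1) := by
      intro i
      obtain ⟨K, hKs, hK, hKμ⟩ := (hmeas ((i + 1) * δ)).exists_isCompact_lt_add (μ := μ)
        (measure_ne_top _ _) (ε := ENNReal.ofReal (ε / (N * δ + 1))) (by simpa using hε')
      obtain ⟨g, hg1, hg0, hg⟩ := ρ.exists_bcf_one_zero hK.isClosed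
        (ρ.isClosed_sublevel ((i + 1) * δ)) (Set.disjoint_left.2 fun x hx hx' =>
          not_lt.2 (show ρ x ≤ (i + 1) * δ from hx') (hKs hx))
      refine ⟨g, fun x => (hg x).1, fun x => ?_, ?_⟩
      · split_ifs with h
        · exact (hg x).2
        · exact (hg0 x (not_lt.1 h)).le
      · have h1 : μ.real {x | (i + 1) * δ < ρ x} ≤ μ.real K + ε / (N * δ + 1) := by
          have := ENNReal.toReal_mono (by finiteness) hKμ.le
          rwa [ENNReal.toReal_add (by finiteness) (by finiteness), ENNReal.toReal_ofReal hε'.le]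
            at this
        have h2 : μ.real K ≤ ∫ x, g x ∂μ := by
          rw [← integral_indicator_one hK.measurableSet]
          refine integral_mono_of_nonneg (ae_of_all _ fun x =>
            Set.indicator_nonneg (fun _ _ => zero_le_one) _) (g.integrable μ) (ae_of_all _ fun x => ?_)
          by_cases hx : x ∈ K
          · simp [hx, hg1 x hx]
          · simp [hx, (hg x).1]
        linarith
    choose g hg0 hg1 hg2 using this
    have e : ∀ x, (∑ i ∈ Finset.range N, δ • g i) x = ∑ i ∈ Finset.range N, δ * g i x := by
      intro x; simp [BoundedContinuousFunction.sum_apply]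
    have hb := hC (∑ i ∈ Finset.range N, δ • g i)
      (fun x => by rw [e]; exact Finset.sum_nonneg fun i _ => mul_nonneg hδ.le (hg0 i x))
      (fun x => by
        rw [e]
        refine le_trans (Finset.sum_le_sum fun i _ => ?_) (sum_step_le (ρ.pos x).le hδ N)
        have := mul_le_mul_of_nonneg_left (hg1 i x) hδ.le
        simpa using this)
    simp_rw [e] at hb
    rw [integral_finsetSum _ fun i _ => ((g i).integrable μ).const_mul δ] at hb
    simp_rw [integral_const_mul] at hb
    calc _ ≤ ∑ i ∈ Finset.range N, (δ * ∫ x, g i x ∂μ + δ * (ε / (N * δ + 1))) :=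
          Finset.sum_le_sum fun i _ => by
            rw [← mul_add]; exact mul_le_mul_of_nonneg_left (hg2 i) hδ.le
      _ = ∑ i ∈ Finset.range N, (δ * ∫ x, g i x ∂μ) + ε * (N * δ / (N * δ + 1)) := by
          rw [Finset.sum_add_distrib]; simp; ring
      _ ≤ C + ε := by
          refine add_le_add hb (mul_le_of_le_one_right hε.le ?_)
          rw [div_le_one (by positivity)]; linarith
  have hC0 : 0 ≤ C := by simpa using hC 0 (fun _ => le_rfl) (fun x => (ρ.pos x).le)
  -- Rounding down loses at most `δ` pointwise, hence at most `δ` times the finite total mass, which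
  -- vanishes as `δ → 0`.
  have hδ : ∀ δ : ℝ≥0, 0 < δ →
      ∫⁻ x, ENNReal.ofReal (ρ x) ∂μ ≤ ENNReal.ofReal C + δ * μ Set.univ := by
    intro δ hδ
    have hδ' : (0 : ℝ) < δ := hδ
    calc _ ≤ ∫⁻ x, ((∑' i : ℕ, {x | (i + 1) * (δ : ℝ) < ρ x}.indicator (fun _ => (δ : ℝ≥0∞)) x)
            + δ) ∂μ := by
          refine lintegral_mono fun x => ?_
          obtain ⟨N, hN⟩ := exists_nat_ge (ρ x / δ)
          rw [div_le_iff₀ hδ'] at hN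
          have h1 := le_sum_step_add hδ' N hN
          calc ENNReal.ofReal (ρ x) ≤ ENNReal.ofReal _ := ENNReal.ofReal_le_ofReal h1
            _ ≤ ∑ i ∈ Finset.range N, {x | (i + 1) * (δ : ℝ) < ρ x}.indicator
                  (fun _ => (δ : ℝ≥0∞)) x + δ := by
                rw [ENNReal.ofReal_add (Finset.sum_nonneg fun i _ => by split_ifs <;> simp) hδ'.le,
                  ENNReal.ofReal_sum_of_nonneg (fun i _ => by split_ifs <;> simp),
                  ENNReal.ofReal_coe_nnreal]
                gcongr with i
                split_ifs with h <;> simp [h]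
            _ ≤ _ := by gcongr; exact ENNReal.sum_le_tsum _
      _ = (∑' i : ℕ, δ * μ {x | (i + 1) * (δ : ℝ) < ρ x}) + δ * μ Set.univ := by
          rw [lintegral_add_right _ measurable_const, lintegral_const,
            lintegral_tsum fun i => (measurable_const.indicator (hmeas _)).aemeasurable]
          simp_rw [lintegral_indicator_const (hmeas _)]
      _ ≤ _ := by
          gcongr
          rw [ENNReal.tsum_eq_iSup_nat]
          refine iSup_le fun N => ?_
          refine le_trans (le_of_eq ?_) (ENNReal.ofReal_le_ofReal (hsum δ hδ' N))
          rw [ENNReal.ofReal_sum_of_nonneg fun i _ => by positivity]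
          refine Finset.sum_congr rfl fun i _ => ?_
          rw [ENNReal.ofReal_mul hδ'.le, ENNReal.ofReal_coe_nnreal, ofReal_measureReal]
  have hlim : Tendsto (fun δ : ℝ≥0 => ENNReal.ofReal C + δ * μ Set.univ) (𝓝[>] 0)
      (𝓝 (ENNReal.ofReal C + (0 : ℝ≥0) * μ Set.univ)) := by
    refine tendsto_const_nhds.add (ENNReal.Tendsto.mul_const ?_ (Or.inr (measure_ne_top _ _)))
    exact (ENNReal.continuous_coe.tendsto 0).mono_left nhdsWithin_le_nhds
  have := ge_of_tendsto hlim (eventually_nhdsWithin_of_forall fun δ h => hδ δ h)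
  simpa using this

end Riesz

open CompactlySupported in
/-- Riesz representation on the Stone–Čech compactification. -/
theorem exists_regular_measure_stoneCech {E : Type*} [TopologicalSpace E] [T35Space E]
    [MeasurableSpace (StoneCech E)] [BorelSpace (StoneCech E)]
    (L : (E →ᵇ ℝ) →ₗ[ℝ] ℝ) (hL : ∀ f : E →ᵇ ℝ, (∀ x, 0 ≤ f x) → 0 ≤ L f) :
    ∃ m : Measure (StoneCech E), m.Regular ∧ IsFiniteMeasure m ∧ ∀ f : StoneCech E →ᵇ ℝ,
      ∫ y, f y ∂m = L (f.compContinuous ⟨stoneCechUnit, continuous_stoneCechUnit⟩) := by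
  let Λ : C_c(StoneCech E, ℝ) →ₚ[ℝ] ℝ := PositiveLinearMap.mk₀
    { toFun := fun f => L
        (f.toBoundedContinuousFunction.compContinuous ⟨stoneCechUnit, continuous_stoneCechUnit⟩)
      map_add' := fun f g => by rw [← map_add]; rfl
      map_smul' := fun c f => by rw [RingHom.id_apply, ← map_smul]; rfl }
    (fun f hf => hL _ fun x => hf _)
  refine ⟨RealRMK.rieszMeasure Λ, inferInstance, inferInstance, fun f => ?_⟩
  exact RealRMK.integral_rieszMeasure Λ ⟨f.toContinuousMap, HasCompactSupport.of_compactSpace _⟩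

/-- Bounded continuous functions extend to the Stone–Čech compactification. -/
theorem exists_bcf_stoneCech {E : Type*} [TopologicalSpace E] (g : E →ᵇ ℝ) :
    ∃ f : StoneCech E →ᵇ ℝ, ∀ x, f (stoneCechUnit x) = g x := by
  have hg : ∀ x, g x ∈ Set.Icc (-‖g‖) ‖g‖ := fun x => abs_le.1 (g.norm_coe_le_norm x)
  let g' : E → Set.Icc (-‖g‖) ‖g‖ := fun x => ⟨g x, hg x⟩
  have hg' : Continuous g' := g.continuous.subtype_mk _
  refine ⟨BoundedContinuousFunction.mkOfCompact
    ⟨fun y => (show Set.Icc (-‖g‖) ‖g‖ from stoneCechExtend hg' y).1,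
      continuous_subtype_val.comp (continuous_stoneCechExtend hg')⟩, fun x => ?_⟩
  exact congrArg Subtype.val (congrFun (stoneCechExtend_extends hg') x)

section Brho

variable {E : Type*} [TopologicalSpace E] {ρ : AdmissibleWeight E}

theorem Brho.norm_ofBCF_le {g : E →ᵇ ℝ} {C : ℝ} (hC : 0 ≤ C) (h : ∀ x, |g x| ≤ C * ρ x) :
    ‖Brho.ofBCF ρ g‖ ≤ C :=
  Brho.norm_le hC h

/-- The inclusion of `C_b(E)` in `𝓑^ρ(E)` as a linear map. -/
noncomputable def Brho.ofBCFₗ (ρ : AdmissibleWeight E) : (E →ᵇ ℝ) →ₗ[ℝ] Brho ρ where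
  toFun := Brho.ofBCF ρ
  map_add' _ _ := rfl
  map_smul' _ _ := rfl

theorem Brho.continuous_approx (f : Brho ρ) :
    ∃ g : ℕ → E →ᵇ ℝ, ∀ n x, |f x - g n x| ≤ 1 / ((n : ℝ) + 1) * ρ x := by
  choose g hg using fun n : ℕ => f.2 (1 / ((n : ℝ) + 1)) Nat.one_div_pos_of_nat
  exact ⟨g, hg⟩

theorem Brho.tendsto_approx {f : Brho ρ} {g : ℕ → E →ᵇ ℝ}
    (hg : ∀ n x, |f x - g n x| ≤ 1 / ((n : ℝ) + 1) * ρ x) (x : E) :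
    Tendsto (fun n => g n x) atTop (𝓝 (f x)) := by
  rw [tendsto_iff_dist_tendsto_zero]
  refine squeeze_zero (fun n => dist_nonneg) (fun n => ?_)
    (by simpa only [zero_mul] using tendsto_one_div_add_atTop_nhds_zero_nat.mul_const (ρ x))
  rw [dist_comm, Real.dist_eq]
  exact hg n x

end Brho

section Riesz

variable {E : Type*} [TopologicalSpace E] [T35Space E] [MeasurableSpace E] [BorelSpace E]
  {ρ : AdmissibleWeight E}

/-- A positive functional on `𝓑^ρ(E)` is represented on `C_b(E)` by a finite Radon measure. -/
theorem exists_measure_bcf (L : Brho ρ →ₗ[ℝ] ℝ) (hL : ∀ f : Brho ρ, (∀ x, 0 ≤ f x) → 0 ≤ L f)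
    {C : ℝ} (hC : ∀ f, |L f| ≤ C * ‖f‖) :
    ∃ μ : Measure E, IsFiniteMeasure μ ∧ μ.InnerRegular ∧
      ∀ g : E →ᵇ ℝ, L (Brho.ofBCF ρ g) = ∫ x, g x ∂μ := by
  let u : E → StoneCech E := stoneCechUnit
  have hu : IsEmbedding u := isEmbedding_stoneCechUnit
  borelize (StoneCech E)
  obtain ⟨m, hm, hmf, hmL⟩ := exists_regular_measure_stoneCech (L ∘ₗ Brho.ofBCFₗ ρ)
    (fun f hf => hL _ hf)
  let K : ℕ → Set (StoneCech E) := fun n => u '' {x | ρ x ≤ n}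
  have hK : ∀ n, IsCompact (K n) := fun n =>
    (ρ.isCompact_sublevel n n.cast_nonneg).image hu.continuous
  have hrange : Set.range u = ⋃ n, K n := by
    rw [← Set.image_univ, ← ρ.iUnion_sublevel, Set.image_iUnion]
  have hrm : MeasurableSet (Set.range u) := by
    rw [hrange]; exact MeasurableSet.iUnion fun n => (hK n).measurableSet
  have hue : MeasurableEmbedding u := hu.measurableEmbedding hrm
  have hC0 : 0 ≤ |C| := abs_nonneg C
  -- A function with values in `[0,1]` that vanishes on `K n` is at most `ρ / n` on `E`, since `ρ >
  -- n` off the sublevel set. So its restriction has weighted norm at most `1 / n`, and the bound on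
  -- `L` controls every compact set disjoint from `K n`.
  have tight : ∀ n : ℕ, 0 < n → m (K n)ᶜ ≤ ENNReal.ofReal (|C| / n) := by
    intro n hn
    have hn' : (0 : ℝ) < n := Nat.cast_pos.2 hn
    rw [(hK n).isClosed.isOpen_compl.measure_eq_iSup_isCompact]
    refine iSup₂_le fun F hF => iSup_le fun hFc => ?_
    obtain ⟨f, h0, h1, hf⟩ := exists_continuous_zero_one_of_isClosed (hK n).isClosed hFc.isClosed
      (Set.disjoint_left.2 fun x hx hx' => hF hx' hx)
    let f' := BoundedContinuousFunction.mkOfCompact f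
    have h2 : m.real F ≤ ∫ y, f' y ∂m := by
      rw [← integral_indicator_one hFc.measurableSet]
      refine integral_mono_of_nonneg (ae_of_all _ fun x =>
        Set.indicator_nonneg (fun _ _ => zero_le_one) _) (f'.integrable m) (ae_of_all _ fun x => ?_)
      by_cases hx : x ∈ F
      · simp [hx, f', h1 hx]
      · simpa [hx, f'] using (hf x).1
    rw [hmL] at h2
    have h3 : ‖Brho.ofBCF ρ (f'.compContinuous ⟨stoneCechUnit, continuous_stoneCechUnit⟩)‖
        ≤ 1 / n := by
      refine Brho.norm_ofBCF_le (by positivity) fun x => ?_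
      show |f (u x)| ≤ _
      rw [abs_of_nonneg (hf _).1]
      by_cases hx : ρ x ≤ n
      · rw [h0 ⟨x, hx, rfl⟩]
        exact mul_nonneg (by positivity) (ρ.pos x).le
      · refine (hf _).2.trans ?_
        rw [one_div_mul_eq_div, le_div_iff₀ hn', one_mul]
        exact (not_le.1 hx).le
    have h4 : m.real F ≤ |C| / n := by
      refine h2.trans ((le_abs_self _).trans ((hC _).trans ?_))
      calc _ ≤ |C| * (1 / n) := mul_le_mul (le_abs_self C) h3 (norm_nonneg _) hC0
        _ = |C| / n := by ring
    rw [← ofReal_measureReal]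
    exact ENNReal.ofReal_le_ofReal h4
  -- By tightness `m` is carried by the σ-compact image of `E`, so it can be pulled back without
  -- losing mass.
  have hnull : m (Set.range u)ᶜ = 0 := by
    have hlim : Tendsto (fun n : ℕ => ENNReal.ofReal (|C| / n)) atTop (𝓝 0) := by
      have := ENNReal.tendsto_ofReal (tendsto_const_div_atTop_nhds_zero_nat |C|)
      simpa using this
    refine le_antisymm (ge_of_tendsto hlim ?_) zero_le
    filter_upwards [eventually_gt_atTop 0] with n hn
    refine (measure_mono ?_).trans (tight n hn)
    rw [Set.compl_subset_compl, hrange]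
    exact Set.subset_iUnion K n
  refine ⟨m.comap u, ?_, ⟨?_⟩, fun g => ?_⟩
  · exact ⟨by rw [hue.comap_apply]; exact measure_lt_top _ _⟩
  -- Compact subsets of the image have compact preimages because `u` is an embedding.
  · refine Measure.InnerRegularWRT.comap (Measure.InnerRegular.innerRegular (μ := m)) hue
      (fun U hU => hue.measurableSet_image.2 hU) fun F hF hFc => ?_
    rw [hu.isCompact_iff, Set.image_preimage_eq_of_subset hF]
    exact hFc
  · obtain ⟨f, hf⟩ := exists_bcf_stoneCech g
    have h1 : ∫ x, g x ∂(m.comap u) = ∫ y, f y ∂((m.comap u).map u) := by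
      rw [hue.integral_map]
      exact integral_congr_ae (ae_of_all _ fun x => (hf x).symm)
    rw [h1, hue.map_comap, Measure.restrict_eq_self_of_ae_mem, hmL]
    · refine congrArg L (Brho.ext fun x => ?_)
      exact (hf x).symm
    · exact measure_eq_zero_iff_ae_notMem.1 hnull |>.mono fun x hx => not_not.1 hx

theorem integrable_weight {μ : Measure E} (h : ∫⁻ x, ENNReal.ofReal (ρ x) ∂μ < ∞) :
    Integrable ρ μ :=
  ⟨ρ.measurable.aestronglyMeasurable, by
    rwa [hasFiniteIntegral_iff_ofReal (ae_of_all _ fun x => (ρ.pos x).le)]⟩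

/-- Riesz representation of positive functionals on `𝓑^ρ(E)`. -/
theorem exists_memMrho (L : Brho ρ →ₗ[ℝ] ℝ) (hL : ∀ f : Brho ρ, (∀ x, 0 ≤ f x) → 0 ≤ L f)
    {C : ℝ} (hC : ∀ f, |L f| ≤ C * ‖f‖) :
    ∃ μ : Measure E, MemMrho ρ μ ∧ ∀ f : Brho ρ, L f = ∫ x, f x ∂μ := by
  obtain ⟨μ, hμ, hμr, hμL⟩ := exists_measure_bcf L hL hC
  have hbd : ∫⁻ x, ENNReal.ofReal (ρ x) ∂μ < ∞ := by
    refine (lintegral_weight_le ρ μ hμr (C := |C|) fun g hg hgρ => ?_).trans_lt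
      ENNReal.ofReal_lt_top
    rw [← hμL]
    refine (le_abs_self _).trans ((hC _).trans ?_)
    have h1 : ‖Brho.ofBCF ρ g‖ ≤ 1 := Brho.norm_ofBCF_le zero_le_one fun x => by
      rw [one_mul, abs_of_nonneg (hg x)]; exact hgρ x
    calc C * ‖Brho.ofBCF ρ g‖ ≤ |C| * 1 :=
          mul_le_mul (le_abs_self C) h1 (norm_nonneg _) (abs_nonneg C)
      _ = |C| := mul_one _
  -- Extension from `C_b(E)` by density: `L` is continuous for the weighted norm, and the integrals
  -- converge by domination with `‖f‖ρ + ρ`.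
  refine ⟨μ, ⟨hμ, hμr, hbd⟩, fun f => ?_⟩
  have hρ := integrable_weight hbd
  obtain ⟨g, hg⟩ := f.continuous_approx
  have h1 : Tendsto (fun n => L (Brho.ofBCF ρ (g n))) atTop (𝓝 (L f)) := by
    rw [tendsto_iff_dist_tendsto_zero]
    refine squeeze_zero (fun n => dist_nonneg) (fun n => ?_)
      (by simpa only [mul_zero] using
        (tendsto_one_div_add_atTop_nhds_zero_nat (𝕜 := ℝ)).const_mul |C|)
    rw [dist_comm, Real.dist_eq, ← map_sub]
    refine (hC _).trans (mul_le_mul (le_abs_self C) ?_ (norm_nonneg _) (abs_nonneg C))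
    exact Brho.norm_le Nat.one_div_pos_of_nat.le (hg n)
  have h2 : Tendsto (fun n => ∫ x, g n x ∂μ) atTop (𝓝 (∫ x, f x ∂μ)) := by
    refine tendsto_integral_of_dominated_convergence (fun x => ‖f‖ * ρ x + 1 * ρ x)
      (fun n => (g n).continuous.measurable.aestronglyMeasurable)
      ((hρ.const_mul _).add (hρ.const_mul _)) (fun n => ae_of_all _ fun x => ?_)
      (ae_of_all _ (Brho.tendsto_approx hg))
    have e : g n x = f x - (f x - g n x) := by ring
    rw [e]
    refine (norm_sub_le _ _).trans (add_le_add (f.abs_apply_le x) ((hg n x).trans ?_))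
    refine mul_le_mul_of_nonneg_right ?_ (ρ.pos x).le
    rw [div_le_one (by positivity)]
    linarith [n.cast_nonneg (α := ℝ)]
  simp_rw [hμL] at h1
  exact tendsto_nhds_unique h1 h2

/-- Evaluation of `P t f` at `x` is a positive functional of `f`, bounded by `ρ x * ‖P t‖`, so Riesz
representation rules out the default value `0` in the definition. -/
theorem transitionMeasure_spec {P : ℝ≥0 → Brho ρ →L[ℝ] Brho ρ}
    (hP : IsGeneralizedFellerSemigroup P) (t : ℝ≥0) (x : E) :
    MemMrho ρ (transitionMeasure P t x) ∧
      ∀ f : Brho ρ, P t f x = ∫ y, f y ∂(transitionMeasure P t x) := by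
  have h : ∃ μ : Measure E, MemMrho ρ μ ∧ ∀ f : Brho ρ, P t f x = ∫ y, f y ∂μ := by
    refine exists_memMrho (C := ρ x * ‖P t‖)
      { toFun := fun f => P t f x
        map_add' := fun f g => by rw [map_add]; rfl
        map_smul' := fun c f => by rw [map_smul]; rfl }
      (fun f hf => hP.positive t f hf x) fun f => ?_
    refine ((P t f).abs_apply_le x).trans ?_
    rw [mul_comm, mul_assoc]
    exact mul_le_mul_of_nonneg_left ((P t).le_opNorm f) (ρ.pos x).le
  rw [transitionMeasure, dif_pos h]
  exact h.choose_spec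

theorem isProbabilityMeasure_transitionMeasure {P : ℝ≥0 → Brho ρ →L[ℝ] Brho ρ}
    (hP : IsGeneralizedFellerSemigroup P) {t : ℝ≥0}
    (ht : P t (Brho.ofBCF ρ 1) = Brho.ofBCF ρ 1) (x : E) :
    IsProbabilityMeasure (transitionMeasure P t x) := by
  obtain ⟨h, hr⟩ := transitionMeasure_spec hP t x
  have := h.isFinite
  have e := hr (Brho.ofBCF ρ 1)
  rw [ht] at e
  simp only [Brho.ofBCF_apply, BoundedContinuousFunction.coe_one, Pi.one_apply, integral_const,
    smul_eq_mul, mul_one] at e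
  exact ⟨by rw [← ofReal_measureReal, ← e, ENNReal.ofReal_one]⟩

end Riesz

/-! ### The Baire σ-algebra and Baire measures -/

section Baire

variable {E : Type*} [TopologicalSpace E]

theorem baireSigmaAlgebra_le [MeasurableSpace E] [OpensMeasurableSpace E] :
    baireSigmaAlgebra E ≤ ‹MeasurableSpace E› :=
  iSup_le fun f => f.continuous.measurable.comap_le

theorem Continuous.measurable_baire {f : E → ℝ} (hf : Continuous f) :
    Measurable[baireSigmaAlgebra E] f :=
  (comap_measurable f).mono (le_iSup (fun f : C(E, ℝ) => MeasurableSpace.comap f (borel ℝ)) ⟨f, hf⟩)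
    (BorelSpace.measurable_eq (α := ℝ)).le

theorem Brho.measurable_baire {ρ : AdmissibleWeight E} (f : Brho ρ) :
    Measurable[baireSigmaAlgebra E] f := by
  obtain ⟨g, hg⟩ := f.continuous_approx
  exact @measurable_of_tendsto_metrizable E ℝ (baireSigmaAlgebra E) _ _ _ _ _ _
    (fun n => (g n).continuous.measurable_baire) (tendsto_pi_nhds.2 (Brho.tendsto_approx hg))

/-- The bounded continuous function `min (c * f⁺) 1`. -/
noncomputable def cutoff (f : C(E, ℝ)) (c : ℝ≥0) : E →ᵇ ℝ :=
  BoundedContinuousFunction.mkOfBound ⟨fun x => min (c * max (f x) 0) 1, by fun_prop⟩ 1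
    fun x y => by
      have h : ∀ z, 0 ≤ min (c * max (f z) 0) 1 := fun z => le_min (by positivity) zero_le_one
      have h' : ∀ z, min (c * max (f z) 0) 1 ≤ 1 := fun z => min_le_right _ _
      rw [Real.dist_eq, abs_le]
      constructor <;> simp only [ContinuousMap.coe_mk] <;> linarith [h x, h y, h' x, h' y]

@[simp] theorem cutoff_apply (f : C(E, ℝ)) (c : ℝ≥0) (x : E) :
    cutoff f c x = min (c * max (f x) 0) 1 := rfl

theorem cutoff_nonneg (f : C(E, ℝ)) (c : ℝ≥0) (x : E) : 0 ≤ cutoff f c x :=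
  le_min (by positivity) zero_le_one

theorem iSup_cutoff (f : C(E, ℝ)) (x : E) :
    ⨆ n : ℕ, ENNReal.ofReal (cutoff f n x) = {x | 0 < f x}.indicator 1 x := by
  by_cases hx : 0 < f x
  · rw [Set.indicator_of_mem (show x ∈ {x | 0 < f x} from hx), Pi.one_apply]
    refine le_antisymm (iSup_le fun n => ?_) ?_
    · simp
    · obtain ⟨n, hn⟩ := exists_nat_ge (1 / f x)
      rw [div_le_iff₀ hx] at hn
      refine le_iSup_of_le n ?_
      rw [cutoff_apply, max_eq_left hx.le, min_eq_right (by simpa using hn), ENNReal.ofReal_one]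
  · rw [Set.indicator_of_notMem (show x ∉ {x | 0 < f x} from hx)]
    simp [max_eq_right (not_lt.1 hx)]

theorem cutoff_mono (f : C(E, ℝ)) {m n : ℕ} (h : m ≤ n) (x : E) : cutoff f m x ≤ cutoff f n x := by
  simp only [cutoff_apply]
  have : ((m : ℝ≥0) : ℝ) ≤ ((n : ℝ≥0) : ℝ) := by exact_mod_cast h
  gcongr

/-- The cozero sets of `E`. -/
def cozeroSets (E : Type*) [TopologicalSpace E] : Set (Set E) :=
  {U | ∃ f : C(E, ℝ), U = {x | 0 < f x}}

theorem isPiSystem_cozeroSets : IsPiSystem (cozeroSets E) := by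
  rintro _ ⟨f, rfl⟩ _ ⟨g, rfl⟩ -
  exact ⟨f ⊓ g, by ext x; simp⟩

theorem baireSigmaAlgebra_eq_generateFrom :
    baireSigmaAlgebra E = MeasurableSpace.generateFrom (cozeroSets E) := by
  refine le_antisymm (iSup_le fun f => ?_) (MeasurableSpace.generateFrom_le ?_)
  · rw [borel_eq_generateFrom_Ioi, MeasurableSpace.comap_generateFrom]
    refine MeasurableSpace.generateFrom_mono ?_
    rintro _ ⟨_, ⟨a, rfl⟩, rfl⟩
    exact ⟨f - ContinuousMap.const E a, by ext x; simp⟩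
  · rintro _ ⟨f, rfl⟩
    exact f.continuous.measurable_baire measurableSet_Ioi

/-- Monotone convergence along the cutoffs. Cozero sets are a π-system generating the Baire
σ-algebra, so integrals of bounded continuous functions control both equality of finite Baire
measures and measurability of kernels. -/
theorem measure_cozero_eq_iSup [MeasurableSpace E]
    (hE : ‹MeasurableSpace E› = baireSigmaAlgebra E) (μ : Measure E) (f : C(E, ℝ)) :
    μ {x : E | 0 < f x} = ⨆ n : ℕ, ∫⁻ x, ENNReal.ofReal (cutoff f n x) ∂μ := by
  subst hE
  rw [← lintegral_iSup]
  · simp_rw [iSup_cutoff]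
    exact (lintegral_indicator_one (f.continuous.measurable_baire measurableSet_Ioi)).symm
  · exact fun n => (cutoff f n).continuous.measurable_baire.ennreal_ofReal
  · exact fun m n h x => ENNReal.ofReal_le_ofReal (cutoff_mono f h x)

/-- Finite Baire measures are determined by the integrals of bounded continuous functions. -/
theorem Measure.ext_of_lintegral_bcf [MeasurableSpace E]
    (hE : ‹MeasurableSpace E› = baireSigmaAlgebra E) {μ ν : Measure E} [IsFiniteMeasure μ]
    (h : ∀ g : E →ᵇ ℝ, (∀ x, 0 ≤ g x) →
      ∫⁻ x, ENNReal.ofReal (g x) ∂μ = ∫⁻ x, ENNReal.ofReal (g x) ∂ν) : μ = ν := by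
  refine ext_of_generate_finite (cozeroSets E) (hE.trans baireSigmaAlgebra_eq_generateFrom)
    isPiSystem_cozeroSets ?_ ?_
  · rintro _ ⟨f, rfl⟩
    rw [measure_cozero_eq_iSup hE, measure_cozero_eq_iSup hE]
    exact iSup_congr fun n => h _ (cutoff_nonneg f n)
  · simpa using h 1 fun _ => zero_le_one

theorem Measurable.measure_of_lintegral_bcf [MeasurableSpace E]
    (hE : ‹MeasurableSpace E› = baireSigmaAlgebra E) {X : Type*} [MeasurableSpace X]
    {κ : X → Measure E} [∀ x, IsProbabilityMeasure (κ x)]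
    (h : ∀ g : E →ᵇ ℝ, (∀ x, 0 ≤ g x) → Measurable fun x => ∫⁻ y, ENNReal.ofReal (g y) ∂(κ x)) :
    Measurable κ := by
  refine Measurable.measure_of_isPiSystem_of_isProbabilityMeasure
    (hE.trans baireSigmaAlgebra_eq_generateFrom) isPiSystem_cozeroSets ?_
  rintro _ ⟨f, rfl⟩
  simp_rw [measure_cozero_eq_iSup hE]
  exact Measurable.iSup fun n => h _ (cutoff_nonneg f n)

/-- The space `E`, carrying its Baire `σ`-algebra. -/
def WithBaire (E : Type*) : Type _ := E

instance : TopologicalSpace (WithBaire E) := inferInstanceAs (TopologicalSpace E)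

instance : MeasurableSpace (WithBaire E) := baireSigmaAlgebra E

theorem WithBaire.measurableSpace_eq :
    instMeasurableSpaceWithBaire = baireSigmaAlgebra (WithBaire E) := rfl

/-- The identity map of `E`, as a map to `E` with its Baire `σ`-algebra. -/
def toBaire (x : E) : WithBaire E := x

theorem measurable_toBaire [MeasurableSpace E] [OpensMeasurableSpace E] :
    Measurable (toBaire : E → WithBaire E) :=
  fun _ h => baireSigmaAlgebra_le _ h

end Baire

/-! ### Baire approximation of Borel sets -/

section Approx

variable {E : Type*} [TopologicalSpace E] [T35Space E] [MeasurableSpace E] [BorelSpace E]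

/-- Compact sets agree with Baire sets up to null sets of a finite Radon measure. -/
theorem exists_baire_ae_eq_of_isCompact (ρ : AdmissibleWeight E) (μ : Measure E)
    [IsFiniteMeasure μ] (hμ : μ.InnerRegular) {K : Set E} (hK : IsCompact K) :
    ∃ B, MeasurableSet[baireSigmaAlgebra E] B ∧ K =ᵐ[μ] B := by
  have : ∀ n : ℕ, ∃ B, MeasurableSet[baireSigmaAlgebra E] B ∧ K ⊆ B ∧
      μ (B \ K) ≤ ((n : ℝ≥0∞) + 1)⁻¹ := by
    intro n
    -- `F` is compact and nearly fills the complement of `K`. A function equal to `1` on `K` and `0`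
    -- on `F` has a cozero set that contains `K` and exceeds it only within `Kᶜ \ F`.
    obtain ⟨F, hFK, hF, hFμ⟩ := hK.measurableSet.compl.exists_isCompact_lt_add (μ := μ)
      (measure_ne_top _ _) (ε := ((n : ℝ≥0∞) + 1)⁻¹) (by simp)
    obtain ⟨g, hg1, hg0, -⟩ := ρ.exists_bcf_one_zero hK.isClosed hF.isClosed
      (Set.disjoint_left.2 fun x hx hx' => hFK hx' hx)
    refine ⟨{x | 0 < g x}, g.continuous.measurable_baire measurableSet_Ioi,
      fun x hx => by simp [hg1 x hx], ?_⟩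
    have h1 : μ ({x | 0 < g x} \ K) ≤ μ (Kᶜ \ F) := measure_mono fun x hx =>
      ⟨hx.2, fun hxF => (ne_of_gt hx.1) (hg0 x hxF)⟩
    refine h1.trans ?_
    rw [measure_sdiff hFK hF.measurableSet.nullMeasurableSet (measure_ne_top _ _)]
    exact tsub_le_iff_left.2 hFμ.le
  choose B hB hKB hBμ using this
  refine ⟨⋂ n, B n, @MeasurableSet.iInter E ℕ (baireSigmaAlgebra E) _ _ hB, ?_⟩
  refine Filter.EventuallyLE.antisymm
    (LE.le.eventuallyLE (Set.subset_iInter hKB)) (ae_le_set.2 ?_)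
  refine le_antisymm (ge_of_tendsto' (ENNReal.tendsto_inv_nat_nhds_zero.comp
    (tendsto_add_atTop_nat 1)) fun n => ?_) zero_le
  refine (measure_mono (Set.sdiff_subset_sdiff_left (Set.iInter_subset B n))).trans ?_
  simpa using hBμ n

/-- Borel sets agree with Baire sets up to null sets of a finite Radon measure. -/
theorem exists_baire_ae_eq (ρ : AdmissibleWeight E) (μ : Measure E)
    [IsFiniteMeasure μ] (hμ : μ.InnerRegular) {S : Set E} (hS : MeasurableSet S) :
    ∃ B, MeasurableSet[baireSigmaAlgebra E] B ∧ S =ᵐ[μ] B := by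
  have : ∀ n : ℕ, ∃ K ⊆ S, IsCompact K ∧ μ (S \ K) ≤ ((n : ℝ≥0∞) + 1)⁻¹ := by
    intro n
    obtain ⟨F, hFK, hF, hFμ⟩ := hS.exists_isCompact_lt_add (μ := μ)
      (measure_ne_top _ _) (ε := ((n : ℝ≥0∞) + 1)⁻¹) (by simp)
    refine ⟨F, hFK, hF, ?_⟩
    rw [measure_sdiff hFK hF.measurableSet.nullMeasurableSet (measure_ne_top _ _)]
    exact tsub_le_iff_left.2 hFμ.le
  choose K hKS hK hKμ using this
  choose B hB hKB using fun n => exists_baire_ae_eq_of_isCompact ρ μ hμ (hK n)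
  refine ⟨⋃ n, B n, @MeasurableSet.iUnion E ℕ (baireSigmaAlgebra E) _ _ hB, ?_⟩
  refine Filter.EventuallyEq.trans ?_ (Filter.EventuallyEq.countable_iUnion hKB)
  refine Filter.EventuallyLE.antisymm (ae_le_set.2 ?_)
    (LE.le.eventuallyLE (Set.iUnion_subset hKS))
  refine le_antisymm (ge_of_tendsto' (ENNReal.tendsto_inv_nat_nhds_zero.comp
    (tendsto_add_atTop_nat 1)) fun n => ?_) zero_le
  refine (measure_mono (Set.sdiff_subset_sdiff_right (Set.subset_iUnion K n))).trans ?_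
  simpa using hKμ n

end Approx

/-- Two functions with the same integrals over the sets of a sub-`σ`-algebra have the same
integrals against the functions measurable for it. -/
theorem lintegral_mul_eq_of_setLIntegral_eq {Ω : Type*} {m m0 : MeasurableSpace Ω} (hm : m ≤ m0)
    {μ : Measure Ω} {u v : Ω → ℝ≥0∞} (hu : Measurable u) (hv : Measurable v)
    (h : ∀ A, MeasurableSet[m] A → ∫⁻ x in A, u x ∂μ = ∫⁻ x in A, v x ∂μ)
    {Z : Ω → ℝ≥0∞} (hZ : Measurable[m] Z) : ∫⁻ x, Z x * u x ∂μ = ∫⁻ x, Z x * v x ∂μ := by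
  -- The hypothesis says exactly that the measures with densities `u` and `v` coincide on `m`, and
  -- `Z` only sees that σ-algebra.
  have e : (μ.withDensity u).trim hm = (μ.withDensity v).trim hm := by
    refine @Measure.ext _ m _ _ fun A hA => ?_
    rw [trim_measurableSet_eq hm hA, trim_measurableSet_eq hm hA, withDensity_apply _ (hm _ hA),
      withDensity_apply _ (hm _ hA), h A hA]
  have key : ∀ w : Ω → ℝ≥0∞, Measurable w →
      ∫⁻ x, Z x * w x ∂μ = ∫⁻ x, Z x ∂((μ.withDensity w).trim hm) := fun w hw => by
    rw [lintegral_trim hm hZ, lintegral_withDensity_eq_lintegral_mul _ hw (hZ.mono hm le_rfl)]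
    simp_rw [Pi.mul_apply, mul_comm]
  rw [key u hu, key v hv, e]

theorem lintegral_bind_map {Ω X Y : Type*} [MeasurableSpace Ω] [MeasurableSpace X]
    [MeasurableSpace Y] {μ : Measure Ω} {f : Ω → X} (hf : Measurable f) {κ : X → Measure Y}
    (hκ : Measurable κ) {g : Y → ℝ≥0∞} (hg : Measurable g) :
    ∫⁻ y, g y ∂((μ.map f).bind κ) = ∫⁻ ω, ∫⁻ y, g y ∂(κ (f ω)) ∂μ := by
  rw [Measure.lintegral_bind hκ.aemeasurable hg.aemeasurable]
  exact lintegral_map ((Measure.measurable_lintegral hg).comp hκ) hf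

/-! ### Transition kernels and the Markov property of `λ` -/

section Transition

variable {E : Type*} [TopologicalSpace E] [T35Space E] [MeasurableSpace E] [BorelSpace E]
  {ρ : AdmissibleWeight E} {P : ℝ≥0 → Brho ρ →L[ℝ] Brho ρ}

theorem lintegral_transitionMeasure_ofReal (hP : IsGeneralizedFellerSemigroup P) (t : ℝ≥0) (x : E)
    {f : Brho ρ} (hf : ∀ x, 0 ≤ f x) :
    ∫⁻ y, ENNReal.ofReal (f y) ∂(transitionMeasure P t x) = ENNReal.ofReal (P t f x) := by
  obtain ⟨h, hr⟩ := transitionMeasure_spec hP t x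
  rw [hr, ofReal_integral_eq_lintegral_ofReal _ (ae_of_all _ hf)]
  refine Integrable.mono' ((integrable_weight h.lintegral_lt_top).const_mul ‖f‖)
    (f.measurable_baire.mono baireSigmaAlgebra_le le_rfl).aestronglyMeasurable
    (ae_of_all _ fun x => f.abs_apply_le x)

/-- The transition measure on the Baire `σ`-algebra. -/
noncomputable def baireTransition (P : ℝ≥0 → Brho ρ →L[ℝ] Brho ρ) (t : ℝ≥0) (x : WithBaire E) :
    Measure (WithBaire E) :=
  (transitionMeasure P t x).map toBaire

theorem lintegral_baireTransition (t : ℝ≥0) (x : E) {g : E → ℝ≥0∞}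
    (hg : Measurable[baireSigmaAlgebra E] g) :
    ∫⁻ y, g y ∂(baireTransition P t x) = ∫⁻ y, g y ∂(transitionMeasure P t x) :=
  lintegral_map (f := fun y : WithBaire E => g y) hg measurable_toBaire

/-- Integrals of bounded continuous `g` are `P t g`, an element of `𝓑^ρ(E)`, hence Baire measurable
as a pointwise limit of continuous functions. The Baire σ-algebra is therefore the natural one for
the kernel. -/
theorem measurable_baireTransition (hP : IsGeneralizedFellerSemigroup P) {t : ℝ≥0}
    (ht : P t (Brho.ofBCF ρ 1) = Brho.ofBCF ρ 1) : Measurable (baireTransition P t) := by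
  have : ∀ x, IsProbabilityMeasure (baireTransition P t x) := fun x =>
    have := isProbabilityMeasure_transitionMeasure hP ht x
    Measure.isProbabilityMeasure_map measurable_toBaire.aemeasurable
  refine Measurable.measure_of_lintegral_bcf WithBaire.measurableSpace_eq fun g hg => ?_
  have e : ∀ x, ∫⁻ y, ENNReal.ofReal (g y) ∂(baireTransition P t x) =
      ENNReal.ofReal (P t (Brho.ofBCF (E := E) ρ g) x) := fun x => by
    rw [← lintegral_transitionMeasure_ofReal (E := E) hP t x (f := Brho.ofBCF (E := E) ρ g) hg]
    exact lintegral_baireTransition (E := E) t x (g := fun y => ENNReal.ofReal (g y))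
      (g.continuous.measurable_baire (E := E)).ennreal_ofReal
  simp_rw [e]
  exact (P t (Brho.ofBCF (E := E) ρ g)).measurable_baire.ennreal_ofReal

theorem measurable_lintegral_transitionMeasure (hP : IsGeneralizedFellerSemigroup P) {t : ℝ≥0}
    (ht : P t (Brho.ofBCF ρ 1) = Brho.ofBCF ρ 1) {g : E → ℝ≥0∞}
    (hg : Measurable[baireSigmaAlgebra E] g) :
    Measurable[baireSigmaAlgebra E] fun x => ∫⁻ y, g y ∂(transitionMeasure P t x) := by
  simp_rw [← lintegral_baireTransition (P := P) t _ hg]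
  exact (Measure.measurable_lintegral (f := fun y : WithBaire E => g y) hg).comp
    (measurable_baireTransition hP ht)

variable {ν : Measure E} {T : ℝ≥0}
  {ℱ : Filtration (TimeInterval T) (MeasurableSpace.pi (X := fun _ : TimeInterval T => E))}
  {ℙ : Measure (TimeInterval T → E)}

/-- Both sides, as functions of `g`, are integrals against Baire measures. The Markov property on
`𝓑^ρ(E)` makes them agree for bounded continuous `g ≥ 0`, and this determines the measures. -/
theorem IsGeneralizedFellerLaw.setLIntegral_eq (hP : IsGeneralizedFellerSemigroup P)
    (hP_one : ∀ t, P t (Brho.ofBCF ρ 1) = Brho.ofBCF ρ 1)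
    (hℙ : IsGeneralizedFellerLaw P ν T ℱ ℙ) {s t : TimeInterval T} (hst : s ≤ t)
    {A : Set (TimeInterval T → E)} (hA : MeasurableSet[ℱ s] A) {g : E → ℝ≥0∞}
    (hg : Measurable[baireSigmaAlgebra E] g) :
    ∫⁻ x in A, g (x t) ∂ℙ =
      ∫⁻ x in A, ∫⁻ y, g y ∂(transitionMeasure P ((t : ℝ≥0) - s) (x s)) ∂ℙ := by
  have := hℙ.isProbabilityMeasure
  set u : ℝ≥0 := (t : ℝ≥0) - s
  have hκ := measurable_baireTransition hP (hP_one u)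
  have hproj : ∀ r : TimeInterval T, Measurable fun x : TimeInterval T → E => toBaire (x r) :=
    fun r => measurable_toBaire.comp (measurable_pi_apply r)
  have hfin : IsFiniteMeasure (((ℙ.restrict A).map fun x => toBaire (x t))) := inferInstance
  have key : (ℙ.restrict A).map (fun x => toBaire (x t)) =
      ((ℙ.restrict A).map fun x => toBaire (x s)).bind (baireTransition P u) := by
    refine Measure.ext_of_lintegral_bcf WithBaire.measurableSpace_eq fun g hg => ?_
    have hgm : Measurable fun y : WithBaire E => ENNReal.ofReal (g y) :=
      (g.continuous.measurable_baire (E := E)).ennreal_ofReal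
    let f : Brho ρ := Brho.ofBCF (E := E) ρ g
    have e : ∀ x, ∫⁻ y, ENNReal.ofReal (g y) ∂(baireTransition P u x) =
        ENNReal.ofReal (P u f x) := fun x => by
      rw [← lintegral_transitionMeasure_ofReal (E := E) hP u x (f := f) hg]
      exact lintegral_baireTransition (E := E) u x (g := fun y => ENNReal.ofReal (g y)) hgm
    rw [lintegral_map hgm (hproj t), lintegral_bind_map (hproj s) hκ hgm]
    simp_rw [e]
    have hA' := ℱ.le s _ hA
    have h1 : ∫ x in A, P u f (x s) ∂ℙ = ∫ x in A, f (x t) ∂ℙ := by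
      rw [← setIntegral_condExp (ℱ.le s) (hℙ.integrable t f) hA]
      exact setIntegral_congr_ae hA' ((hℙ.condExp_eq s t hst f).mono fun x hx _ => hx.symm)
    have h2 := ofReal_integral_eq_lintegral_ofReal
      ((hℙ.integrable t f).integrableOn (s := A)) (ae_of_all _ fun x => hg (x t))
    have h3 := ofReal_integral_eq_lintegral_ofReal
      ((hℙ.integrable s (P u f)).integrableOn (s := A))
      (ae_of_all _ fun x => hP.positive u f hg (x s))
    exact h2.symm.trans ((congrArg ENNReal.ofReal h1.symm).trans h3)
  have hg' : Measurable fun y : WithBaire E => g y := hg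
  have h1 := lintegral_map (μ := ℙ.restrict A) hg' (hproj t)
  rw [key, lintegral_bind_map (hproj s) hκ hg'] at h1
  refine h1.symm.trans (lintegral_congr fun x => ?_)
  exact lintegral_baireTransition u (x s) hg

theorem IsGeneralizedFellerLaw.lintegral_mul_eq (hP : IsGeneralizedFellerSemigroup P)
    (hP_one : ∀ t, P t (Brho.ofBCF ρ 1) = Brho.ofBCF ρ 1)
    (hℙ : IsGeneralizedFellerLaw P ν T ℱ ℙ) {s t : TimeInterval T} (hst : s ≤ t)
    {Z : (TimeInterval T → E) → ℝ≥0∞} (hZ : Measurable[ℱ s] Z) {g : E → ℝ≥0∞}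
    (hg : Measurable[baireSigmaAlgebra E] g) :
    ∫⁻ x, Z x * g (x t) ∂ℙ =
      ∫⁻ x, Z x * ∫⁻ y, g y ∂(transitionMeasure P ((t : ℝ≥0) - s) (x s)) ∂ℙ := by
  have hm : ∀ {h : E → ℝ≥0∞}, Measurable[baireSigmaAlgebra E] h → ∀ r : TimeInterval T,
      Measurable fun x : TimeInterval T → E => h (x r) := fun hh r =>
    (hh.mono baireSigmaAlgebra_le le_rfl).comp (measurable_pi_apply r)
  exact lintegral_mul_eq_of_setLIntegral_eq (ℱ.le s) (hm hg t)
    (hm (measurable_lintegral_transitionMeasure hP (hP_one _) hg) s)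
    (fun A hA => hℙ.setLIntegral_eq hP hP_one hst hA hg) hZ

end Transition

theorem measurable_indicator_one {α M : Type*} {_ : MeasurableSpace α} [MeasurableSpace M]
    [Zero M] [One M] {B : Set α} (hB : MeasurableSet B) :
    Measurable (B.indicator (1 : α → M)) :=
  measurable_one.indicator hB

/-! ### Functions extended to the cemetery -/

namespace WithCemetery

variable {E : Type*}

/-- The extension of an extended nonnegative function on `E` to `E ∪ {Δ}` by `0` at `Δ`. -/
noncomputable def lextend (g : E → ℝ≥0∞) (y : WithCemetery E) : ℝ≥0∞ := Option.elim y 0 g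

@[simp] theorem lextend_incl (g : E → ℝ≥0∞) (x : E) : lextend g (incl x) = g x := rfl

@[simp] theorem lextend_cemetery (g : E → ℝ≥0∞) : lextend g cemetery = 0 := rfl

theorem eq_cemetery_or_incl (y : WithCemetery E) : y = cemetery ∨ ∃ x, y = incl x := by
  rcases y with _ | x
  · exact Or.inl rfl
  · exact Or.inr ⟨x, rfl⟩

theorem ofReal_extend (f : E → ℝ) (y : WithCemetery E) :
    ENNReal.ofReal (extend f y) = lextend (fun x => ENNReal.ofReal (f x)) y := by
  rcases y with _ | x
  · exact ENNReal.ofReal_zero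
  · rfl

theorem lextend_mul (f g : E → ℝ≥0∞) (y : WithCemetery E) :
    lextend (fun x => f x * g x) y = lextend f y * lextend g y := by
  rcases y with _ | x
  · exact (zero_mul _).symm
  · rfl

theorem lextend_const_mul (c : ℝ≥0∞) (g : E → ℝ≥0∞) (y : WithCemetery E) :
    lextend (fun x => c * g x) y = c * lextend g y := by
  rcases y with _ | x
  · exact (mul_zero _).symm
  · rfl

theorem lextend_add (f g : E → ℝ≥0∞) (y : WithCemetery E) :
    lextend (fun x => f x + g x) y = lextend f y + lextend g y := by
  rcases y with _ | x
  · exact (zero_add _).symm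
  · rfl

theorem lextend_iSup {ι : Type*} (f : ι → E → ℝ≥0∞) (y : WithCemetery E) :
    lextend (fun x => ⨆ n, f n x) y = ⨆ n, lextend (f n) y := by
  rcases y with _ | x
  · exact ENNReal.iSup_zero.symm
  · rfl

theorem lextend_mono {f g : E → ℝ≥0∞} (h : f ≤ g) (y : WithCemetery E) :
    lextend f y ≤ lextend g y := by
  rcases y with _ | x
  · exact le_rfl
  · exact h x

theorem preimage_singleton_cemetery : (incl ⁻¹' {cemetery} : Set E) = ∅ := by
  ext x
  refine ⟨fun h => ?_, fun h => h.elim⟩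
  cases h

variable [MeasurableSpace E]

theorem measurableSet_singleton_cemetery : MeasurableSet ({cemetery} : Set (WithCemetery E)) := by
  show MeasurableSet (incl ⁻¹' {cemetery})
  rw [preimage_singleton_cemetery]
  exact MeasurableSet.empty

theorem measurable_lextend {g : E → ℝ≥0∞} (hg : Measurable g) : Measurable (lextend g) :=
  fun _ hS => hg hS

theorem measurable_extend {g : E → ℝ} (hg : Measurable g) : Measurable (extend g) :=
  fun _ hS => hg hS

end WithCemetery

open WithCemetery

/-! ### The Markov property of the extended process -/

section ExtendedTransition

section WeightedAction

variable {E : Type*} [TopologicalSpace E] [T2Space E] [MeasurableSpace E]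
  {ρ : AdmissibleWeight E} {P : ℝ≥0 → Brho ρ →L[ℝ] Brho ρ}

/-- The operators `g ↦ P(t)(g ρ) / ρ` on nonnegative functions. -/
noncomputable def weightedAction (P : ℝ≥0 → Brho ρ →L[ℝ] Brho ρ) (t : ℝ≥0) (g : E → ℝ≥0∞)
    (x : E) : ℝ≥0∞ :=
  (∫⁻ y, g y * ENNReal.ofReal (ρ y) ∂(transitionMeasure P t x)) / ENNReal.ofReal (ρ x)

/-- This cancellation, valid as `0 < ρ x < ∞`, makes the product of density ratios telescope. -/
theorem weightedAction_mul_weight (t : ℝ≥0) (g : E → ℝ≥0∞) (x : E) :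
    weightedAction P t g x * ENNReal.ofReal (ρ x) =
      ∫⁻ y, g y * ENNReal.ofReal (ρ y) ∂(transitionMeasure P t x) :=
  ENNReal.div_mul_cancel (by simpa using ρ.pos x) ENNReal.ofReal_ne_top

end WeightedAction

variable {E : Type*} [TopologicalSpace E] [T35Space E] [MeasurableSpace E] [BorelSpace E]
  {ρ : AdmissibleWeight E} {P : ℝ≥0 → Brho ρ →L[ℝ] Brho ρ}

theorem measurable_weightedAction (hρ : Measurable[baireSigmaAlgebra E] ρ)
    (hP : IsGeneralizedFellerSemigroup P) {t : ℝ≥0}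
    (ht : P t (Brho.ofBCF ρ 1) = Brho.ofBCF ρ 1) {g : E → ℝ≥0∞}
    (hg : Measurable[baireSigmaAlgebra E] g) :
    Measurable[baireSigmaAlgebra E] (weightedAction P t g) := by
  refine Measurable.div ?_ hρ.ennreal_ofReal
  exact measurable_lintegral_transitionMeasure hP ht (hg.mul hρ.ennreal_ofReal)

theorem ofReal_extendedAction_indicator (hP : IsGeneralizedFellerSemigroup P) (t : ℝ≥0)
    {B : Set E} (hB : MeasurableSet B) (x : E) :
    ENNReal.ofReal (extendedAction P t (fun z => B.indicator 1 z * ρ z) x / ρ x) =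
      weightedAction P t (B.indicator 1) x := by
  have h := (transitionMeasure_spec hP t x).1
  have hi := integrable_weight h.lintegral_lt_top
  have e : (fun z => B.indicator (1 : E → ℝ) z * ρ z) = B.indicator ρ := by
    ext z; by_cases hz : z ∈ B <;> simp [hz]
  rw [ENNReal.ofReal_div_of_pos (ρ.pos x), extendedAction, e,
    ofReal_integral_eq_lintegral_ofReal (hi.indicator hB)
      (ae_of_all _ fun z => Set.indicator_nonneg (fun z _ => (ρ.pos z).le) z), weightedAction]
  congr 1
  refine lintegral_congr fun z => ?_
  by_cases hz : z ∈ B <;> simp [hz]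

variable {ν : Measure (WithCemetery E)} {T : ℝ≥0}
  {ℱ : Filtration (TimeInterval T)
    (MeasurableSpace.pi (X := fun _ : TimeInterval T => WithCemetery E))}
  {ℙ : Measure (TimeInterval T → WithCemetery E)}

theorem IsExtendedFellerLaw.setLIntegral_indicator (hP : IsGeneralizedFellerSemigroup P)
    (hℙ : IsExtendedFellerLaw P ν T ℱ ℙ) {s t : TimeInterval T} (hst : s ≤ t)
    {A : Set (TimeInterval T → WithCemetery E)} (hA : MeasurableSet[ℱ s] A) {B : Set E}
    (hB : MeasurableSet[baireSigmaAlgebra E] B) :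
    ∫⁻ y in A, lextend (B.indicator 1) (y t) ∂ℙ =
      ∫⁻ y in A, lextend (weightedAction P ((t : ℝ≥0) - s) (B.indicator 1)) (y s) ∂ℙ := by
  have := hℙ.isProbabilityMeasure
  have hB' : MeasurableSet B := baireSigmaAlgebra_le _ hB
  set F : E → ℝ := fun x =>
    extendedAction P ((t : ℝ≥0) - s) (fun z => B.indicator 1 z * ρ z) x / ρ x with hF
  have hb : ∀ x, |B.indicator (1 : E → ℝ) x| ≤ 1 := fun x => by
    by_cases hx : x ∈ B <;> simp [hx]
  have h0 := hℙ.condExp_eq s t hst (B.indicator 1)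
    (measurable_indicator_one hB) ⟨1, hb⟩
  have hint : Integrable (fun y => extend (B.indicator 1) (y t)) ℙ := by
    refine Integrable.of_bound ((measurable_extend (measurable_one.indicator hB')).comp
      (measurable_pi_apply t)).aestronglyMeasurable 1 (ae_of_all _ fun y => ?_)
    rcases eq_cemetery_or_incl (y t) with h | ⟨x, h⟩ <;> simp only [h]
    · exact (abs_zero.trans_le zero_le_one)
    · exact hb x
  have hFi : Integrable (fun y => extend F (y s)) ℙ := integrable_condExp.congr h0
  have h1 : ∫ y in A, extend F (y s) ∂ℙ = ∫ y in A, extend (B.indicator 1) (y t) ∂ℙ := by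
    rw [← setIntegral_condExp (ℱ.le s) hint hA]
    exact setIntegral_congr_ae (ℱ.le s _ hA) (h0.mono fun x hx _ => hx.symm)
  have hF0 : ∀ x, 0 ≤ F x := fun x =>
    div_nonneg (integral_nonneg fun z => mul_nonneg
      (Set.indicator_nonneg (fun _ _ => zero_le_one) z) (ρ.pos z).le) (ρ.pos x).le
  have hext : ∀ {f : E → ℝ}, (∀ x, 0 ≤ f x) → ∀ y, 0 ≤ extend f y := fun hf y => by
    rcases y with _ | x
    · exact le_rfl
    · exact hf x
  have h2 := congrArg ENNReal.ofReal h1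
  rw [ofReal_integral_eq_lintegral_ofReal hFi.integrableOn (ae_of_all _ fun y => hext hF0 _),
    ofReal_integral_eq_lintegral_ofReal hint.integrableOn (ae_of_all _ fun y => hext
      (Set.indicator_nonneg fun _ _ => zero_le_one) _)] at h2
  simp_rw [ofReal_extend] at h2
  have e1 : (fun x => ENNReal.ofReal (F x)) =
      weightedAction P ((t : ℝ≥0) - s) (B.indicator 1) :=
    funext (ofReal_extendedAction_indicator hP _ hB')
  have e2 : (fun x => ENNReal.ofReal (B.indicator 1 x)) = B.indicator 1 := by
    ext x; by_cases hx : x ∈ B <;> simp [hx]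
  rw [e1, e2] at h2
  exact h2.symm

/-- Both sides are additive, homogeneous and continuous along increasing sequences in `g`, so
indicators suffice. Unbounded `g` with values in `[0,∞]` arise when transition operators are
iterated. -/
theorem IsExtendedFellerLaw.setLIntegral_eq (hρ : Measurable[baireSigmaAlgebra E] ρ)
    (hP : IsGeneralizedFellerSemigroup P) (hP_one : ∀ t, P t (Brho.ofBCF ρ 1) = Brho.ofBCF ρ 1)
    (hℙ : IsExtendedFellerLaw P ν T ℱ ℙ) {s t : TimeInterval T} (hst : s ≤ t)
    {A : Set (TimeInterval T → WithCemetery E)} (hA : MeasurableSet[ℱ s] A) {g : E → ℝ≥0∞}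
    (hg : Measurable[baireSigmaAlgebra E] g) :
    ∫⁻ y in A, lextend g (y t) ∂ℙ =
      ∫⁻ y in A, lextend (weightedAction P ((t : ℝ≥0) - s) g) (y s) ∂ℙ := by
  set u : ℝ≥0 := (t : ℝ≥0) - s with hu
  have hw : ∀ {h : E → ℝ≥0∞}, Measurable[baireSigmaAlgebra E] h →
      Measurable fun x => h x * ENNReal.ofReal (ρ x) := fun hh =>
    (hh.mono baireSigmaAlgebra_le le_rfl).mul ρ.measurable.ennreal_ofReal
  have hm : ∀ {h : E → ℝ≥0∞}, Measurable[baireSigmaAlgebra E] h → ∀ r : TimeInterval T,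
      Measurable fun y : TimeInterval T → WithCemetery E => lextend h (y r) := fun hh r =>
    (measurable_lextend (hh.mono baireSigmaAlgebra_le le_rfl)).comp (measurable_pi_apply r)
  have hΘ : ∀ {h : E → ℝ≥0∞}, Measurable[baireSigmaAlgebra E] h →
      Measurable[baireSigmaAlgebra E] (weightedAction P u h) := fun hh =>
    measurable_weightedAction hρ hP (hP_one u) hh
  refine @Measurable.ennreal_induction E (baireSigmaAlgebra E)
    (fun g => ∫⁻ y in A, lextend g (y t) ∂ℙ = ∫⁻ y in A, lextend (weightedAction P u g) (y s) ∂ℙ)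
    (fun c B hB => ?_) (fun f g _ hf hg ihf ihg => ?_) (fun f hf hmono ih => ?_) g hg
  · have e : B.indicator (fun _ => c) = fun x => c * B.indicator (1 : E → ℝ≥0∞) x := by
      ext x; by_cases hx : x ∈ B <;> simp [hx]
    have hB1 : Measurable[baireSigmaAlgebra E] (B.indicator (1 : E → ℝ≥0∞)) :=
      measurable_indicator_one hB
    have e' : weightedAction P u (fun x => c * B.indicator (1 : E → ℝ≥0∞) x) =
        fun x => c * weightedAction P u (B.indicator (1 : E → ℝ≥0∞)) x := by
      ext x
      simp only [weightedAction, mul_assoc]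
      rw [lintegral_const_mul _ (hw hB1), mul_div_assoc]
    simp only [e, e', lextend_const_mul]
    rw [lintegral_const_mul _ (hm hB1 t), lintegral_const_mul _ (hm (hΘ hB1) s),
      hℙ.setLIntegral_indicator hP hst hA hB]
  · have e : weightedAction P u (f + g) =
        fun x => weightedAction P u f x + weightedAction P u g x := by
      ext x
      simp only [weightedAction, Pi.add_apply, add_mul]
      rw [lintegral_add_left (hw hf), ENNReal.add_div]
    have e' : f + g = fun x => f x + g x := rfl
    rw [e, e']
    simp only [lextend_add]
    rw [lintegral_add_left (hm hf t), lintegral_add_left (hm (hΘ hf) s), ihf, ihg]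
  · have e : weightedAction P u (fun x => ⨆ n, f n x) =
        fun x => ⨆ n, weightedAction P u (f n) x := by
      ext x
      simp only [weightedAction, ENNReal.iSup_mul]
      rw [lintegral_iSup (fun n => hw (hf n))
        fun m n h z => mul_le_mul_left (hmono h z) _, ENNReal.iSup_div]
    have hmono' : Monotone fun n => weightedAction P u (f n) := fun m n h x =>
      ENNReal.div_le_div_right (lintegral_mono fun z => mul_le_mul_left (hmono h z) _) _
    rw [e]
    simp only [lextend_iSup]
    rw [lintegral_iSup (fun n => hm (hf n) t) fun m n h y => lextend_mono (hmono h) _,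
      lintegral_iSup (fun n => hm (hΘ (hf n)) s) fun m n h y => lextend_mono (hmono' h) _]
    exact iSup_congr ih

theorem IsExtendedFellerLaw.lintegral_mul_eq (hρ : Measurable[baireSigmaAlgebra E] ρ)
    (hP : IsGeneralizedFellerSemigroup P) (hP_one : ∀ t, P t (Brho.ofBCF ρ 1) = Brho.ofBCF ρ 1)
    (hℙ : IsExtendedFellerLaw P ν T ℱ ℙ) {s t : TimeInterval T} (hst : s ≤ t)
    {Z : (TimeInterval T → WithCemetery E) → ℝ≥0∞} (hZ : Measurable[ℱ s] Z) {g : E → ℝ≥0∞}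
    (hg : Measurable[baireSigmaAlgebra E] g) :
    ∫⁻ y, Z y * lextend g (y t) ∂ℙ =
      ∫⁻ y, Z y * lextend (weightedAction P ((t : ℝ≥0) - s) g) (y s) ∂ℙ := by
  have hm : ∀ {h : E → ℝ≥0∞}, Measurable[baireSigmaAlgebra E] h → ∀ r : TimeInterval T,
      Measurable fun y : TimeInterval T → WithCemetery E => lextend h (y r) := fun hh r =>
    (measurable_lextend (hh.mono baireSigmaAlgebra_le le_rfl)).comp (measurable_pi_apply r)
  exact lintegral_mul_eq_of_setLIntegral_eq (ℱ.le s) (hm hg t)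
    (hm (measurable_weightedAction hρ hP (hP_one _) hg) s)
    (fun A hA => hℙ.setLIntegral_eq hρ hP hP_one hst hA hg) hZ

/-- The cemetery is absorbing. -/
theorem IsExtendedFellerLaw.measure_cemetery_incl (hP : IsGeneralizedFellerSemigroup P)
    (hℙ : IsExtendedFellerLaw P ν T ℱ ℙ) {s t : TimeInterval T} (hst : s ≤ t) :
    ℙ {y | y s = cemetery ∧ y t ≠ cemetery} = 0 := by
  have hc : MeasurableSet ({cemetery} : Set (WithCemetery E)) := measurableSet_singleton_cemetery
  have hA : MeasurableSet[ℱ s] {y : TimeInterval T → WithCemetery E | y s = cemetery} :=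
    hℙ.adapted s hc
  have hAt : MeasurableSet {y : TimeInterval T → WithCemetery E | y t ≠ cemetery} :=
    (hc.preimage (measurable_pi_apply t)).compl
  -- For the indicator of all of `E`, the left side is the probability of being dead at `s` and
  -- alive at `t`; the right side vanishes because extended functions are `0` at the cemetery.
  have h := hℙ.setLIntegral_indicator hP hst hA (B := Set.univ)
    (@MeasurableSet.univ _ (baireSigmaAlgebra E))
  have h1 : ∫⁻ y in {y | y s = cemetery},
      lextend (weightedAction P ((t : ℝ≥0) - s) (Set.univ.indicator 1)) (y s) ∂ℙ = 0 := by
    rw [setLIntegral_congr_fun (g := fun _ => 0) (ℱ.le s _ hA)]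
    · simp
    · intro y hy
      have hy' : y s = cemetery := hy
      simp [hy']
  rw [h1] at h
  have e : (fun y : TimeInterval T → WithCemetery E => lextend (Set.univ.indicator 1) (y t)) =
      {y | y t ≠ cemetery}.indicator 1 := by
    ext y
    rcases eq_cemetery_or_incl (y t) with hy | ⟨x, hy⟩
    · simp [hy]
    · have : y ∈ {y : TimeInterval T → WithCemetery E | y t ≠ cemetery} := by
        simp only [Set.mem_ofPred_eq, hy]; rintro ⟨⟩
      simp [hy, Set.indicator_of_mem this]
  rw [e, lintegral_indicator_one hAt, Measure.restrict_apply hAt] at h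
  rw [← h]
  congr 1
  ext y
  exact and_comm

end ExtendedTransition

/-! ### Finite-dimensional distributions -/

section FiniteDimensional

variable {E : Type*} [TopologicalSpace E] [T35Space E] [MeasurableSpace E] [BorelSpace E]
  {ρ : AdmissibleWeight E} {P : ℝ≥0 → Brho ρ →L[ℝ] Brho ρ} {ν : Measure E} {T : ℝ≥0}
  {ℱ : Filtration (TimeInterval T) (MeasurableSpace.pi (X := fun _ : TimeInterval T => E))}
  {ℙ : Measure (TimeInterval T → E)}
  {ℱ' : Filtration (TimeInterval T)
    (MeasurableSpace.pi (X := fun _ : TimeInterval T => WithCemetery E))}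
  {ℙ' : Measure (TimeInterval T → WithCemetery E)}

theorem TimeInterval.initial_le (t : TimeInterval T) : TimeInterval.initial T ≤ t :=
  Subtype.coe_le_coe.1 (zero_le : (0 : ℝ≥0) ≤ t)

theorem TimeInterval.le_final (t : TimeInterval T) : t ≤ TimeInterval.final T :=
  Subtype.coe_le_coe.1 t.2.2

/-- The finite-dimensional distributions of the extended Feller process, on `E`, are obtained from
those of the generalized Feller process by the density `ρ(λ_t) / ρ(λ_0)`. -/
theorem lintegral_prod_extended_eq (hρ : Measurable[baireSigmaAlgebra E] ρ)
    (hP : IsGeneralizedFellerSemigroup P) (hP_one : ∀ t, P t (Brho.ofBCF ρ 1) = Brho.ofBCF ρ 1)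
    (hℙ : IsGeneralizedFellerLaw P ν T ℱ ℙ)
    (hℙ' : IsExtendedFellerLaw P (ν.map WithCemetery.incl) T ℱ' ℙ')
    {g : TimeInterval T → E → ℝ≥0∞} (hg : ∀ i, Measurable[baireSigmaAlgebra E] (g i))
    (s : Finset (TimeInterval T)) : ∀ t, (∀ i ∈ s, i ≤ t) → ∀ h : E → ℝ≥0∞,
      Measurable[baireSigmaAlgebra E] h →
      ∫⁻ y, (∏ i ∈ s, lextend (g i) (y i)) * lextend h (y t) ∂ℙ' =
        ∫⁻ x, (∏ i ∈ s, g i (x i)) * (ENNReal.ofReal (ρ (x (TimeInterval.initial T))))⁻¹ *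
          (h (x t) * ENNReal.ofReal (ρ (x t))) ∂ℙ := by
  have hle := baireSigmaAlgebra_le (E := E)
  have hZ : ∀ {h : E → ℝ≥0∞}, Measurable[baireSigmaAlgebra E] h → ∀ {i m : TimeInterval T},
      i ≤ m → Measurable[ℱ m] fun x : TimeInterval T → E => h (x i) := fun hh i m him =>
    ((hh.mono hle le_rfl).comp (hℙ.adapted i)).mono (ℱ.mono him) le_rfl
  have hZ' : ∀ {h : E → ℝ≥0∞}, Measurable[baireSigmaAlgebra E] h → ∀ {i m : TimeInterval T},
      i ≤ m → Measurable[ℱ' m] fun y : TimeInterval T → WithCemetery E => lextend h (y i) :=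
    fun hh i m him =>
    ((measurable_lextend (hh.mono hle le_rfl)).comp (hℙ'.adapted i)).mono (ℱ'.mono him) le_rfl
  have hw : Measurable[baireSigmaAlgebra E] fun x => ENNReal.ofReal (ρ x) := hρ.ennreal_ofReal
  -- Induction peels off the latest time `m`: conditioning at `m` replaces `h` at `t` by `g m` times
  -- the transform of `h` at `m`. This is why `t` and `h` are quantified inside.
  induction s using Finset.induction_on_max with
  | empty =>
    intro t _ h hh
    have hΘ := (measurable_weightedAction hρ hP
      (hP_one ((t : ℝ≥0) - (TimeInterval.initial T : ℝ≥0))) hh).mono hle le_rfl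
    simp only [Finset.prod_empty, one_mul]
    have h1 := hℙ'.lintegral_mul_eq hρ hP hP_one (TimeInterval.initial_le t)
      (Z := fun _ => 1) measurable_const hh
    simp only [one_mul] at h1
    rw [h1, hℙ.lintegral_mul_eq hP hP_one (TimeInterval.initial_le t)
      (Z := fun x => (ENNReal.ofReal (ρ (x (TimeInterval.initial T))))⁻¹) (hZ hw le_rfl).inv
      (g := fun y => h y * ENNReal.ofReal (ρ y)) (hh.mul hw)]
    -- Conditioned at time `0`, both sides depend only on the initial position, whose law is `ν` or
    -- its image in `E ∪ {Δ}`.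
    rw [← lintegral_map (f := lextend _) (μ := ℙ') (measurable_lextend hΘ)
      (measurable_pi_apply (TimeInterval.initial T)), hℙ'.initial_law,
      lintegral_map (measurable_lextend hΘ) measurable_incl, ← hℙ.initial_law]
    simp only [lextend_incl]
    rw [lintegral_map hΘ (measurable_pi_apply _)]
    refine lintegral_congr fun x => ?_
    rw [weightedAction, ENNReal.div_eq_inv_mul]
  | insert m s hlt ih =>
    intro t ht h hh
    have hms : m ∉ s := fun hm => lt_irrefl _ (hlt m hm)
    have hmt : m ≤ t := ht m (Finset.mem_insert_self m s)
    have hΘ := measurable_weightedAction hρ hP (hP_one ((t : ℝ≥0) - m)) hh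
    have hprod : Measurable[ℱ m] fun x : TimeInterval T → E =>
        (∏ i ∈ insert m s, g i (x i)) *
          (ENNReal.ofReal (ρ (x (TimeInterval.initial T))))⁻¹ := by
      refine Measurable.mul (Finset.measurable_prod _ fun i hi => hZ (hg i) ?_)
        (hZ hw (TimeInterval.initial_le m)).inv
      rcases Finset.mem_insert.1 hi with rfl | hi
      · exact le_rfl
      · exact (hlt i hi).le
    have hprod' : Measurable[ℱ' m] fun y : TimeInterval T → WithCemetery E =>
        ∏ i ∈ insert m s, lextend (g i) (y i) := by
      refine Finset.measurable_prod _ fun i hi => hZ' (hg i) ?_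
      rcases Finset.mem_insert.1 hi with rfl | hi
      · exact le_rfl
      · exact (hlt i hi).le
    rw [hℙ'.lintegral_mul_eq hρ hP hP_one hmt hprod' hh,
      hℙ.lintegral_mul_eq hP hP_one hmt hprod
        (g := fun y => h y * ENNReal.ofReal (ρ y)) (hh.mul hw)]
    have h2 := ih m (fun i hi => (hlt i hi).le) _ ((hg m).mul hΘ)
    refine Eq.trans (lintegral_congr fun y => ?_) (h2.trans (lintegral_congr fun x => ?_))
    · rw [Finset.prod_insert hms]
      have := lextend_mul (g m) (weightedAction P ((t : ℝ≥0) - m) h) (y m)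
      change _ = _ * lextend (fun x => g m x * weightedAction P ((t : ℝ≥0) - m) h x) (y m)
      rw [this]
      ring
    · rw [Finset.prod_insert hms]
      have e : (g m * weightedAction P ((t : ℝ≥0) - m) h) (x m) * ENNReal.ofReal (ρ (x m)) =
          g m (x m) * ∫⁻ y, h y * ENNReal.ofReal (ρ y) ∂(transitionMeasure P ((t : ℝ≥0) - m) (x m))
          := by
        rw [← weightedAction_mul_weight, Pi.mul_apply, mul_assoc]
      rw [e]
      ring

end FiniteDimensional

/-- Measurable sets of a product space depend on countably many coordinates. -/
theorem exists_countable_of_measurableSet_pi {I X : Type*} [MeasurableSpace X] {D : Set (I → X)}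
    (hD : MeasurableSet D) :
    ∃ J : Set I, J.Countable ∧ ∀ x y : I → X, (∀ j ∈ J, x j = y j) → x ∈ D → y ∈ D := by
  let m : MeasurableSpace (I → X) :=
    { MeasurableSet' := fun D => ∃ J : Set I, J.Countable ∧
        ∀ x y : I → X, (∀ j ∈ J, x j = y j) → x ∈ D → y ∈ D
      measurableSet_empty := ⟨∅, Set.countable_empty, fun _ _ _ h => h⟩
      measurableSet_compl := by
        rintro D ⟨J, hJ, h⟩
        exact ⟨J, hJ, fun x y hxy hx hy => hx (h y x (fun j hj => (hxy j hj).symm) hy)⟩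
      measurableSet_iUnion := by
        intro D hD
        choose J hJ h using hD
        refine ⟨⋃ n, J n, Set.countable_iUnion hJ, fun x y hxy hx => ?_⟩
        obtain ⟨n, hn⟩ := Set.mem_iUnion.1 hx
        exact Set.mem_iUnion.2 ⟨n, h n x y (fun j hj => hxy j (Set.mem_iUnion.2 ⟨n, hj⟩)) hn⟩ }
  have hm : MeasurableSpace.pi ≤ m := by
    refine iSup_le fun i => ?_
    rintro _ ⟨S, -, rfl⟩
    refine ⟨{i}, Set.countable_singleton i, fun x y hxy hx => ?_⟩
    have hx' : x i ∈ S := hx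
    show y i ∈ S
    rwa [← hxy i rfl]
  exact hm D hD

theorem WithCemetery.measurableEmbedding_incl {E : Type*} [MeasurableSpace E] :
    MeasurableEmbedding (incl : E → WithCemetery E) :=
  ⟨incl_injective, measurable_incl, fun _ h => measurableSet_image_incl h⟩

theorem WithCemetery.isFiniteMeasure_trace {E I : Type*} [MeasurableSpace E]
    (m : Measure (I → WithCemetery E)) [IsFiniteMeasure m] : IsFiniteMeasure (trace m) :=
  ⟨by rw [trace_apply m MeasurableSet.univ]; exact measure_lt_top _ _⟩

theorem WithCemetery.lextend_indicator_prod_eq {E I : Type*} (s : Finset I) (S : I → Set E) (t : I)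
    (y : I → WithCemetery E) :
    (∏ i ∈ s, lextend ((S i).indicator 1) (y i)) * lextend 1 (y t) =
      ((s : Set I).pi (fun i => incl '' S i) ∩ {y | y t ≠ cemetery}).indicator 1 y := by
  classical
  have h1 : ∀ i, lextend ((S i).indicator 1) (y i) =
      if y i ∈ incl '' S i then 1 else 0 := fun i => by
    rcases eq_cemetery_or_incl (y i) with h | ⟨x, h⟩
    · rw [h, if_neg]
      · rfl
      · rintro ⟨z, -, ⟨⟩⟩
    · rw [h, incl_injective.mem_set_image]; rfl
  have h2 : lextend 1 (y t) = if y t ≠ cemetery then 1 else 0 := by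
    rcases eq_cemetery_or_incl (y t) with h | ⟨x, h⟩
    · simp [h]
    · rw [h, if_pos]
      · rfl
      · rintro ⟨⟩
  simp_rw [h1, h2]
  rw [Finset.prod_ite_zero, Set.indicator_apply]
  simp only [Finset.prod_const_one, ite_mul, one_mul, zero_mul, ← ite_and]
  exact if_congr Iff.rfl rfl rfl

/-! ### The trace on `E`-valued paths and its density -/

section Trace

variable {E : Type*} [TopologicalSpace E] [T35Space E] [MeasurableSpace E] [BorelSpace E]
  {ρ : AdmissibleWeight E} {P : ℝ≥0 → Brho ρ →L[ℝ] Brho ρ} {T : ℝ≥0}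

/-- The trace on `E^{[0,T]}` of the law of an extended Feller process is carried by the paths that
are alive at time `T`. -/
theorem IsExtendedFellerLaw.trace_preimage_inclPath {ν : Measure (WithCemetery E)}
    {ℱ : Filtration (TimeInterval T)
      (MeasurableSpace.pi (X := fun _ : TimeInterval T => WithCemetery E))}
    {ℙ : Measure (TimeInterval T → WithCemetery E)} (hP : IsGeneralizedFellerSemigroup P)
    (hℙ : IsExtendedFellerLaw P ν T ℱ ℙ) {B : Set (TimeInterval T → WithCemetery E)}
    (hB : MeasurableSet B) (hB' : MeasurableSet (inclPath ⁻¹' B : Set (TimeInterval T → E))) :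
    trace ℙ (inclPath ⁻¹' B) = ℙ (B ∩ {y | y (TimeInterval.final T) ≠ cemetery}) := by
  rw [trace_apply ℙ hB']
  refine le_antisymm (measure_mono ?_) ?_
  · rintro _ ⟨x, hx, rfl⟩
    refine ⟨hx, ?_⟩
    rintro ⟨⟩
  -- `C` is a measurable hull realizing the outer measure, so it remains to show that `(B ∩ F) \ C`
  -- is null.
  set C := toMeasurable ℙ (inclPath '' (inclPath ⁻¹' B : Set (TimeInterval T → E))) with hC
  set F : Set (TimeInterval T → WithCemetery E) := {y | y (TimeInterval.final T) ≠ cemetery}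
  have hF : MeasurableSet F :=
    (measurableSet_singleton_cemetery.preimage (measurable_pi_apply (TimeInterval.final T))).compl
  have hD : MeasurableSet ((B ∩ F) \ C) := (hB.inter hF).diff (measurableSet_toMeasurable _ _)
  obtain ⟨J, hJ, hJD⟩ := exists_countable_of_measurableSet_pi hD
  -- If a path in the difference were alive at every time of `J`, changing it off `J` would give an
  -- `E`-valued path still in the difference; but `E`-valued paths in `B` belong to `C`. So the path
  -- revives from the cemetery, a null event for each `j`.
  have hsub : (B ∩ F) \ C ⊆ ⋃ j ∈ J, {y | y j = cemetery ∧ y (TimeInterval.final T) ≠ cemetery} := by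
    intro y hy
    by_contra hcon
    simp only [Set.mem_iUnion, not_exists] at hcon
    have hyT : y (TimeInterval.final T) ≠ cemetery := hy.1.2
    obtain ⟨x₀, -⟩ := (eq_cemetery_or_incl (y (TimeInterval.final T))).resolve_left hyT
    have hx : ∀ j, ∃ x : E, j ∈ J → y j = incl x := fun j => by
      rcases eq_cemetery_or_incl (y j) with h | ⟨x, h⟩
      · exact ⟨x₀, fun hj => (hcon j hj ⟨h, hyT⟩).elim⟩
      · exact ⟨x, fun _ => h⟩
    choose x hx using hx
    have hxD := hJD y (inclPath x) hx hy
    exact hxD.2 (subset_toMeasurable _ _ ⟨x, hxD.1.1, rfl⟩)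
  have hnull : ℙ ((B ∩ F) \ C) = 0 :=
    measure_mono_null hsub ((measure_biUnion_null_iff hJ).2 fun j _ =>
      hℙ.measure_cemetery_incl hP (TimeInterval.le_final j))
  calc ℙ (B ∩ F) ≤ ℙ (C ∪ (B ∩ F) \ C) := measure_mono (by
        rw [Set.union_sdiff_self]; exact Set.subset_union_right)
    _ ≤ ℙ C + ℙ ((B ∩ F) \ C) := measure_union_le _ _
    _ = _ := by rw [hnull, add_zero, hC, measure_toMeasurable]

variable {ν : Measure E}
  {ℱ : Filtration (TimeInterval T) (MeasurableSpace.pi (X := fun _ : TimeInterval T => E))}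
  {ℙ : Measure (TimeInterval T → E)}
  {ℱ' : Filtration (TimeInterval T)
    (MeasurableSpace.pi (X := fun _ : TimeInterval T => WithCemetery E))}
  {ℙ' : Measure (TimeInterval T → WithCemetery E)}

/-- Borel sets can be replaced by Baire sets up to null sets of the marginals of both laws. -/
theorem exists_baire_ae_eq_marginals (hℙ : IsGeneralizedFellerLaw P ν T ℱ ℙ)
    {ν' : Measure (WithCemetery E)} (hℙ' : IsExtendedFellerLaw P ν' T ℱ' ℙ')
    (t : TimeInterval T) {S : Set E} (hS : MeasurableSet S) :
    ∃ B, MeasurableSet[baireSigmaAlgebra E] B ∧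
      (∀ᵐ x ∂ℙ, S.indicator (1 : E → ℝ≥0∞) (x t) = B.indicator 1 (x t)) ∧
      ∀ᵐ y ∂ℙ', lextend (S.indicator 1) (y t) = lextend (B.indicator 1) (y t) := by
  have := hℙ.isProbabilityMeasure
  have := hℙ'.isProbabilityMeasure
  have := hℙ.radon_marginal t
  have := hℙ'.radon_marginal t
  have : IsFiniteMeasure ((ℙ'.map fun y => y t).comap incl) :=
    ⟨by rw [measurableEmbedding_incl.comap_apply]; exact measure_lt_top _ _⟩
  -- Approximating with respect to the sum of the two marginals gives one Baire set that serves both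
  -- laws.
  obtain ⟨B, hB, hSB⟩ := exists_baire_ae_eq ρ
    ((ℙ.map fun x => x t) + (ℙ'.map fun y => y t).comap incl) inferInstance hS
  have hB' : MeasurableSet B := baireSigmaAlgebra_le _ hB
  have hind : ∀ x : E, (x ∈ S ↔ x ∈ B) →
      S.indicator (1 : E → ℝ≥0∞) x = B.indicator 1 x := fun x hx => by
    by_cases h : x ∈ S
    · simp [h, hx.1 h]
    · simp [h, mt hx.2 h]
  obtain ⟨h1, h2⟩ := ae_add_measure_iff.1 hSB.mem_iff
  refine ⟨B, hB, ?_, ?_⟩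
  · exact (ae_of_ae_map (measurable_pi_apply t).aemeasurable h1).mono fun x hx => hind _ hx
  · rw [ae_iff, measurableEmbedding_incl.comap_apply] at h2
    have h3 := ae_of_ae_map (measurable_pi_apply t).aemeasurable
      (measure_eq_zero_iff_ae_notMem.1 h2)
    filter_upwards [h3] with y hy
    rcases eq_cemetery_or_incl (y t) with h | ⟨x, h⟩
    · simp [h]
    · simp only [h, lextend_incl]
      exact hind x (not_not.1 fun hx => hy ⟨x, hx, h.symm⟩)

/-- The trace of the law of the extended Feller process has the density `ρ(λ_T) / ρ(λ_0)`. -/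
theorem trace_eq_withDensity (hρ : Measurable[baireSigmaAlgebra E] ρ)
    (hP : IsGeneralizedFellerSemigroup P) (hP_one : ∀ t, P t (Brho.ofBCF ρ 1) = Brho.ofBCF ρ 1)
    (hℙ : IsGeneralizedFellerLaw P ν T ℱ ℙ)
    (hℙ' : IsExtendedFellerLaw P (ν.map WithCemetery.incl) T ℱ' ℙ') :
    trace ℙ' = ℙ.withDensity fun x => ENNReal.ofReal
      (ρ (x (TimeInterval.final T)) / ρ (x (TimeInterval.initial T))) := by
  have := hℙ'.isProbabilityMeasure
  have := isFiniteMeasure_trace ℙ'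
  have key : ∀ S ∈ squareCylinders fun _ : TimeInterval T => {s : Set E | MeasurableSet s},
      trace ℙ' S = (ℙ.withDensity fun x => ENNReal.ofReal
        (ρ (x (TimeInterval.final T)) / ρ (x (TimeInterval.initial T)))) S := by
    rintro _ ⟨s, t, ht, rfl⟩
    have ht' : ∀ i, MeasurableSet (t i) := fun i => ht i trivial
    have hm : MeasurableSet ((s : Set (TimeInterval T)).pi t) :=
      MeasurableSet.pi s.countable_toSet fun i _ => ht' i
    choose B hB hBℙ hBℙ' using fun i => exists_baire_ae_eq_marginals hℙ hℙ' i (ht' i)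
    have e : (s : Set (TimeInterval T)).pi t =
        inclPath ⁻¹' ((s : Set (TimeInterval T)).pi fun i => incl '' t i) := by
      ext x
      exact forall₂_congr fun i _ => incl_injective.mem_set_image.symm
    have hm' : MeasurableSet ((s : Set (TimeInterval T)).pi fun i => incl '' t i) :=
      MeasurableSet.pi s.countable_toSet fun i _ => measurableSet_image_incl (ht' i)
    have hF : MeasurableSet {y : TimeInterval T → WithCemetery E |
        y (TimeInterval.final T) ≠ cemetery} :=
      (measurableSet_singleton_cemetery.preimage
        (measurable_pi_apply (TimeInterval.final T))).compl
    rw [withDensity_apply _ hm, ← lintegral_indicator hm, e,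
      hℙ'.trace_preimage_inclPath hP hm' (e ▸ hm), ← lintegral_indicator_one (hm'.inter hF), ← e]
    simp_rw [← lextend_indicator_prod_eq]
    have h1 : ∫⁻ y, (∏ i ∈ s, lextend ((t i).indicator 1) (y i)) *
        lextend 1 (y (TimeInterval.final T)) ∂ℙ' =
        ∫⁻ y, (∏ i ∈ s, lextend ((B i).indicator 1) (y i)) *
          lextend 1 (y (TimeInterval.final T)) ∂ℙ' := by
      refine lintegral_congr_ae ?_
      filter_upwards [(Finset.eventually_all s).2 fun i _ => hBℙ' i] with y hy
      rw [Finset.prod_congr rfl hy]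
    -- The test function `1` at time `T` encodes survival on the extended side and leaves the factor
    -- `ρ(λ_T)` on the other.
    rw [h1, lintegral_prod_extended_eq hρ hP hP_one hℙ hℙ'
      (g := fun i => (B i).indicator 1) (fun i => measurable_indicator_one (hB i)) s
      (TimeInterval.final T) (fun i _ => TimeInterval.le_final i) 1
      (measurable_const : Measurable[baireSigmaAlgebra E] fun _ : E => (1 : ℝ≥0∞))]
    refine lintegral_congr_ae ?_
    filter_upwards [(Finset.eventually_all s).2 fun i _ => hBℙ i] with x hx
    rw [← Finset.prod_congr rfl hx, Pi.one_apply, one_mul, mul_assoc, ← ENNReal.div_eq_inv_mul,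
      ← ENNReal.ofReal_div_of_pos (ρ.pos _)]
    by_cases hxt : x ∈ (s : Set (TimeInterval T)).pi t
    · rw [Set.indicator_of_mem hxt, Finset.prod_eq_one, one_mul]
      exact fun i hi => Set.indicator_of_mem (hxt i hi) _
    · rw [Set.indicator_of_notMem hxt]
      simp only [Set.mem_pi, not_forall] at hxt
      obtain ⟨i, hi, hxi⟩ := hxt
      rw [Finset.prod_eq_zero hi (Set.indicator_of_notMem hxi _), zero_mul]
  refine ext_of_generate_finite _ generateFrom_squareCylinders.symm
    (isPiSystem_squareCylinders (fun _ => MeasurableSpace.isPiSystem_measurableSet)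
      fun _ => MeasurableSet.univ) key ?_
  -- The total masses agree because the whole space is the cylinder over no coordinates.
  exact key _ ⟨∅, fun _ => Set.univ, fun _ _ => MeasurableSet.univ, by simp⟩

end Trace

theorem mainTheorem4 {E : Type*} [TopologicalSpace E] [T35Space E] [MeasurableSpace E]
    [BorelSpace E] (ρ : AdmissibleWeight E) (hρ : Measurable[baireSigmaAlgebra E] ρ)
    (P : ℝ≥0 → Brho ρ →L[ℝ] Brho ρ) (hP : IsGeneralizedFellerSemigroup P)
    (hP_one : ∀ t, P t (Brho.ofBCF ρ 1) = Brho.ofBCF ρ 1)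
    (hP_contractive : ∀ t, ‖P t‖ ≤ 1)
    (ν : Measure E) [IsProbabilityMeasure ν]
    (T : ℝ≥0) (hT : 0 < T)
    (ℱ : Filtration (TimeInterval T) (MeasurableSpace.pi (X := fun _ : TimeInterval T => E)))
    (ℙ : Measure (TimeInterval T → E))
    (hℙ : IsGeneralizedFellerLaw P ν T ℱ ℙ)
    (ℱ' : Filtration (TimeInterval T)
      (MeasurableSpace.pi (X := fun _ : TimeInterval T => WithCemetery E)))
    (ℙ' : Measure (TimeInterval T → WithCemetery E))
    (hℙ' : IsExtendedFellerLaw P (ν.map WithCemetery.incl) T ℱ' ℙ') :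
    (∀ A : Set (TimeInterval T → E), MeasurableSet A →
      WithCemetery.trace ℙ' A =
        ∫⁻ x in A, ENNReal.ofReal
          (ρ (x (TimeInterval.final T)) / ρ (x (TimeInterval.initial T))) ∂ℙ) ∧
    (∀ A : Set (TimeInterval T → E), MeasurableSet A →
      ∫⁻ x in A, ENNReal.ofReal
          (ρ (x (TimeInterval.initial T)) / ρ (x (TimeInterval.final T)))
            ∂(WithCemetery.trace ℙ') = ℙ A) ∧
    WithCemetery.trace ℙ' ≪ ℙ ∧ ℙ ≪ WithCemetery.trace ℙ' := by
  have hq := trace_eq_withDensity hρ hP hP_one hℙ hℙ'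
  set d : (TimeInterval T → E) → ℝ≥0∞ := fun x => ENNReal.ofReal
    (ρ (x (TimeInterval.final T)) / ρ (x (TimeInterval.initial T))) with hd
  have hproj : ∀ t : TimeInterval T, Measurable fun x : TimeInterval T → E => ρ (x t) := fun t =>
    ρ.measurable.comp (measurable_pi_apply t)
  have hdm : Measurable d :=
    ((hproj (TimeInterval.final T)).div (hproj (TimeInterval.initial T))).ennreal_ofReal
  have hd0 : ∀ x, d x ≠ 0 := fun x => by
    simpa [hd] using div_pos (ρ.pos _) (ρ.pos _)
  rw [hq]
  refine ⟨fun A hA => withDensity_apply _ hA, fun A hA => ?_,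
    withDensity_absolutelyContinuous _ _,
    withDensity_absolutelyContinuous' hdm.aemeasurable (ae_of_all _ hd0)⟩
  rw [setLIntegral_withDensity_eq_setLIntegral_mul _ hdm
    (g := fun x : TimeInterval T → E => ENNReal.ofReal
      (ρ (x (TimeInterval.initial T)) / ρ (x (TimeInterval.final T))))
    ((hproj (TimeInterval.initial T)).div (hproj (TimeInterval.final T))).ennreal_ofReal hA]
  -- The two ratios are mutually inverse at every path, so integrating the second against the
  -- density returns `ℙ`.
  have e : ∀ x : TimeInterval T → E, (d * fun x : TimeInterval T → E => ENNReal.ofReal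
      (ρ (x (TimeInterval.initial T)) / ρ (x (TimeInterval.final T)))) x = 1 := fun x => by
    have h1 := ρ.pos (x (TimeInterval.initial T))
    have h2 := ρ.pos (x (TimeInterval.final T))
    rw [Pi.mul_apply, hd, ← ENNReal.ofReal_mul (div_pos h2 h1).le, div_mul_div_cancel₀ h1.ne',
      div_self h2.ne', ENNReal.ofReal_one]
  simp_rw [e]
  simp
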